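/- Let $(R,\mathfrak m)$ be a one-dimensional Noetherian local domain with quotient field $Q$, let $E=E_R(R/\mathfrak m)$ be an injective hull of its residue field, and let $\hat R$ be the $\mathfrak m$-adic completion of $R$. The set $\operatorname{Ass}\hat R=\{\mathfrak q_1,\ldots,\mathfrak q_r\}$ of associated primes of the $\hat R$-module $\hat R$ is finite. For each $i$ let $E_{\hat R}(\hat R/\mathfrak q_i)$ be an injective hull of the $\hat R$-module $\hat R/\mathfrak q_i$. Then: 1. $E$ has an $\hat R$-module structure extending its $R$-module structure, and for every such structure there is an isomorphism of $\hat R$-modules $$\operatorname{Hom}_R(Q,E)\;\cong\;\bigoplus_{i=1}^r E_{\hat R}(\hat R/\mathfrak q_i),$$ where $\hat R$ acts on $\operatorname{Hom}_R(Q,E)$ through $E$. 2. There is an isomorphism of $\hat R$-algebras $$Q\otimes_R\hat R\;\cong\;\bigoplus_{i=1}^r\widehat{\hat R_{\mathfrak q_i}},$$ where $\widehat{\hat R_{\mathfrak q_i}}$ is the completion of the local ring $\hat R_{\mathfrak q_i}$ at its maximal ideal, and the finite direct sum on the right is the product of rings. -/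

import Mathlib

open scoped TensorProduct DirectSum

universe u v

/-- The `R`-module `E` is an injective hull of the `R`-module `M`: it is an injective module
together with an embedding `M → E` that is essential, i.e. every submodule of `E` that meets
the image of `M` trivially is zero. -/
def IsInjectiveHull (R : Type u) [CommRing R] (M : Type u) [AddCommGroup M] [Module R M]
    (E : Type u) [AddCommGroup E] [Module R E] : Prop :=
  Module.Injective R E ∧
    ∃ f : M →ₗ[R] E, Function.Injective f ∧
      ∀ N : Submodule R E, N ⊓ LinearMap.range f = ⊥ → N = ⊥

/-- Every module has an injective hull. -/
theorem exists_isInjectiveHull (R : Type u) [CommRing R] (M : Type u) [AddCommGroup M]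
    [Module R M] : ∃ (E : Type u) (_ : AddCommGroup E) (_ : Module R E),
      IsInjectiveHull R M E := by
  obtain ⟨I, _, _, hI, j, hj⟩ : ∃ (I : Type u) (_ : AddCommGroup I) (_ : Module R I),
      Module.Injective R I ∧ ∃ j : M →ₗ[R] I, Function.Injective j := by
    obtain ⟨⟨J, hJ, f, hf⟩⟩ := CategoryTheory.EnoughInjectives.presentation (ModuleCat.of R M)
    exact ⟨J, inferInstance, inferInstance, Module.injective_module_of_injective_object R J,
      f.hom, (ModuleCat.mono_iff_injective f).1 hf⟩
  let P := LinearMap.range j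
  let S : Set (Submodule R I) := {N | P ≤ N ∧ ∀ L ≤ N, L ⊓ P = ⊥ → L = ⊥}
  have hPS : P ∈ S := ⟨le_rfl, fun L hL h ↦ by rwa [inf_eq_left.2 hL] at h⟩
  have hzorn : ∃ N, P ≤ N ∧ Maximal (· ∈ S) N := by
    refine zorn_le_nonempty₀ S (fun c hcS hc y hy ↦ ?_) P hPS
    refine ⟨sSup c, ⟨(hcS hy).1.trans (le_sSup hy), fun L hL h ↦ ?_⟩, fun z hz ↦ le_sSup hz⟩
    rw [Submodule.eq_bot_iff]
    intro x hx
    obtain ⟨N, hN, hxN⟩ := (Submodule.mem_sSup_of_directed ⟨y, hy⟩ hc.directedOn).1 (hL hx)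
    have h1 : L ⊓ N = ⊥ := (hcS hN).2 _ inf_le_right
      (le_bot_iff.1 ((inf_le_inf_right P inf_le_left).trans h.le))
    exact (Submodule.eq_bot_iff _).1 h1 x ⟨hx, hxN⟩
  obtain ⟨N, hPN, hNS, hNmax⟩ := hzorn
  have hK : ∃ K : Submodule R I, ⊥ ≤ K ∧ Maximal (fun K : Submodule R I ↦ K ⊓ N = ⊥) K := by
    refine zorn_le_nonempty₀ {K : Submodule R I | K ⊓ N = ⊥} (fun c hcS hc y hy ↦ ?_) ⊥
      (bot_inf_eq N)
    refine ⟨sSup c, ?_, fun z hz ↦ le_sSup hz⟩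
    refine (Submodule.eq_bot_iff _).2 ?_
    rintro x ⟨hx, hxN⟩
    obtain ⟨K, hK, hxK⟩ := (Submodule.mem_sSup_of_directed ⟨y, hy⟩ hc.directedOn).1 hx
    exact (Submodule.eq_bot_iff _).1 (hcS hK) x ⟨hxK, hxN⟩
  obtain ⟨K, -, hKN, hKmax⟩ := hK
  let π : N →ₗ[R] I ⧸ K := K.mkQ ∘ₗ N.subtype
  have hπ : Function.Injective π := by
    rw [injective_iff_map_eq_zero]
    intro x hx
    have : (x : I) ∈ K := by simpa [π] using hx
    exact Subtype.ext ((Submodule.eq_bot_iff _).1 hKN x ⟨this, x.2⟩)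
  obtain ⟨g, hg⟩ := hI.out π hπ N.subtype
  -- submodules of `I` that strictly contain `K` meet `N`
  have hess : ∀ T : Submodule R I, K ≤ T → T ⊓ N = ⊥ → T ≤ K := fun T hT h ↦ hKmax h hT
  let G : I →ₗ[R] I := g ∘ₗ K.mkQ
  have hGN : ∀ x ∈ N, G x = x := fun x hx ↦ hg ⟨x, hx⟩
  have hKG : ∀ x ∈ K, G x = 0 := fun x hx ↦ by
    simp [G, (Submodule.Quotient.mk_eq_zero K).2 hx]
  have hker : LinearMap.ker G ≤ K := by
    refine hess _ (fun x hx ↦ hKG x hx) ((Submodule.eq_bot_iff _).2 ?_)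
    rintro x ⟨hx, hxN⟩
    rw [← hGN x hxN]; exact hx
  have hNG : N ≤ LinearMap.range G := fun x hx ↦ ⟨x, hGN x hx⟩
  have hGS : LinearMap.range G ∈ S := by
    refine ⟨hPN.trans hNG, fun L hL h ↦ ?_⟩
    have hLN : L ⊓ N = ⊥ := hNS.2 _ inf_le_right
      (le_bot_iff.1 ((inf_le_inf_right P inf_le_left).trans h.le))
    have h1 : L.comap G ≤ K := by
      refine hess _ (fun x hx ↦ by simp [hKG x hx]) ((Submodule.eq_bot_iff _).2 ?_)
      rintro x ⟨hx, hxN⟩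
      refine (Submodule.eq_bot_iff _).1 hLN x ⟨?_, hxN⟩
      rw [← hGN x hxN]; exact hx
    rw [Submodule.eq_bot_iff]
    intro x hx
    obtain ⟨y, rfl⟩ := hL hx
    exact hKG y (h1 hx)
  have hle : LinearMap.range G ≤ N := hNmax hGS hNG
  let ρ : I →ₗ[R] N := G.codRestrict N fun x ↦ hle ⟨x, rfl⟩
  refine ⟨N, inferInstance, inferInstance, ⟨fun X Y _ _ _ _ i hi φ ↦ ?_⟩,
    j.codRestrict N fun x ↦ hPN ⟨x, rfl⟩, fun a b hab ↦ hj (congrArg Subtype.val hab), ?_⟩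
  · obtain ⟨h, hh⟩ := hI.out i hi (N.subtype ∘ₗ φ)
    refine ⟨ρ ∘ₗ h, fun x ↦ Subtype.ext ?_⟩
    change G (h (i x)) = φ x
    rw [hh]
    exact hGN _ (φ x).2
  · intro L hL
    have h1 : L.map N.subtype = ⊥ := by
      refine hNS.2 _ (Submodule.map_subtype_le N L) ((Submodule.eq_bot_iff _).2 ?_)
      rintro _ ⟨⟨x, hx, rfl⟩, ⟨m, hm⟩⟩
      have : x = 0 := (Submodule.eq_bot_iff _).1 hL x ⟨hx, ⟨m, Subtype.ext hm⟩⟩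
      simp [this]
    exact Submodule.map_injective_of_injective N.subtype_injective
      (h1.trans (Submodule.map_bot _).symm)

/-- The completion of a local ring: its adic completion at the maximal ideal. -/
abbrev LocalCompletion (R : Type u) [CommRing R] [IsLocalRing R] : Type u :=
  AdicCompletion (IsLocalRing.maximalIdeal R) R

instance associatedPrimes.isPrime_coe (A : Type u) [CommRing A] (q : associatedPrimes A A) :
    (q : Ideal A).IsPrime :=
  q.2.isPrime

/-! Write `A` for the completion and fix a nonzero `a` in the maximal ideal of `R`. In dimension
one, `Q` is the union of the `R a⁻ⁿ`. By flatness `a` is regular on `A`, and `A` has dimension at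
most one, so the associated primes of `A` are exactly the nonmaximal primes. They are minimal and
pairwise incomparable, and an ideal inside none of them contains a power of `a`.

For the first part, elements of `E` are killed by powers of the maximal ideal, so `A` acts on `E`,
and Artin–Rees makes `E` injective over `A`. As `Q` is `R`-flat, `Hom_R(Q, E)` is injective over
`A`. It remains to embed the sum of the `A/q` essentially in it, since essential extensions of one
module that are injective are isomorphic. Each `q` is the annihilator of some map `Q → E`, which
gives the embedding. Essentiality says that each `q` occurs only once: two maps killed by `q` are
dependent over `A/q`. Otherwise a copy of `(A/q)²` in `Hom_R(Q, E)`, evaluated at `a⁻ⁿ`, would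
produce submodules of `E` whose lengths grow twice as fast as Matlis duality permits
(`exists_smul_add_smul_eq_zero`); Chevalley's theorem makes the comparison of kernels uniform.

For the second part, `Q ⊗ A` inverts the nonzero elements of `R`. This leaves only the minimal
primes of `A`, so the result is the product of the Artinian local rings `A_q`, which are already
complete. -/

section

open IsLocalRing

/-! ### Completions of local rings, and ideals in dimension one -/

/-- A flat local homomorphism of local rings presenting `A` as the completion of `R`. -/
structure IsLocalCompletion (R A : Type*) [CommRing R] [IsLocalRing R] [CommRing A] [IsLocalRing A]
    [Algebra R A] : Prop where
  map_eq : (maximalIdeal R).map (algebraMap R A) = maximalIdeal A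
  exists_sub_mem : ∀ (n : ℕ) (x : A), ∃ r : R, x - algebraMap R A r ∈ maximalIdeal A ^ n
  isAdicComplete : IsAdicComplete (maximalIdeal A) A
  flat : Module.Flat R A

theorem isLocalCompletion_localCompletion (R : Type u) [CommRing R] [IsLocalRing R]
    [IsNoetherianRing R] : IsLocalCompletion R (LocalCompletion R) where
  map_eq := AdicCompletion.maximalIdeal_eq_map.symm
  exists_sub_mem n x := by
    obtain ⟨r, hr⟩ := Submodule.Quotient.mk_surjective _ (x.val n)
    refine ⟨r, ?_⟩
    have h : x - algebraMap R (LocalCompletion R) r ∈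
        (maximalIdeal R ^ n • ⊤ : Submodule R (LocalCompletion R)) := by
      rw [AdicCompletion.pow_smul_top_eq_ker_eval (maximalIdeal R).fg_of_isNoetherianRing]
      simp only [LinearMap.mem_ker, map_sub, AdicCompletion.eval_apply]
      rw [← hr, sub_eq_zero]
      rfl
    rw [Ideal.smul_top_eq_map, Submodule.restrictScalars_mem, Ideal.map_pow] at h
    rwa [AdicCompletion.maximalIdeal_eq_map]
  isAdicComplete := inferInstance
  flat := AdicCompletion.flat_of_isNoetherian _

theorem exists_maximalIdeal_pow_le {R : Type*} [CommRing R] [IsLocalRing R] [IsNoetherianRing R]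
    (J : Ideal R) (hJ : ∀ p : Ideal R, p.IsPrime → J ≤ p → maximalIdeal R ≤ p) :
    ∃ n, maximalIdeal R ^ n ≤ J := by
  refine Ideal.exists_pow_le_of_le_radical_of_fg ?_ (maximalIdeal R).fg_of_isNoetherianRing
  rw [Ideal.radical_eq_sInf]
  exact le_sInf fun p hp ↦ hJ p hp.2 hp.1

section OneDim

variable {R : Type*} [CommRing R] [IsDomain R] [IsLocalRing R] [IsNoetherianRing R]

omit [IsNoetherianRing R] in
theorem maximalIdeal_le_of_isPrime_of_ne_bot (hdim : ringKrullDim R = 1) (p : Ideal R)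
    [hp : p.IsPrime] (h : p ≠ ⊥) : maximalIdeal R ≤ p := by
  have : Ring.KrullDimLE 1 R := by
    rw [Ring.krullDimLE_iff]; exact hdim.le
  exact (eq_maximalIdeal (hp.isMaximal_of_ne_bot h)).ge

theorem exists_maximalIdeal_pow_le_span (hdim : ringKrullDim R = 1) {a : R} (ha : a ≠ 0) :
    ∃ n, maximalIdeal R ^ n ≤ Ideal.span {a} := by
  refine exists_maximalIdeal_pow_le _ fun p hp hap ↦ maximalIdeal_le_of_isPrime_of_ne_bot hdim p ?_
  rintro rfl
  exact ha (by simpa using hap)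

omit [IsDomain R] [IsNoetherianRing R] in
theorem exists_ne_zero_mem_maximalIdeal (hdim : ringKrullDim R = 1) :
    ∃ a ∈ maximalIdeal R, a ≠ 0 := by
  by_contra! h
  have hf : IsField R := by
    rw [isField_iff_maximalIdeal_eq]
    exact (Submodule.eq_bot_iff _).2 h
  rw [ringKrullDim_eq_zero_of_isField hf] at hdim
  exact zero_ne_one hdim

end OneDim

/-! ### The completion is Noetherian; its associated primes -/

theorem Submodule.mem_ideal_smul_top_pi {A ι : Type*} [CommRing A] [Finite ι] (I : Ideal A)
    (x : ι → A) : x ∈ (I • ⊤ : Submodule A (ι → A)) ↔ ∀ i, x i ∈ I := by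
  classical
  have := Fintype.ofFinite ι
  refine ⟨fun hx i ↦ ?_, fun hx ↦ ?_⟩
  · have := Submodule.mem_map_of_mem (f := LinearMap.proj (R := A) (φ := fun _ : ι ↦ A) i) hx
    rw [Submodule.map_smul''] at this
    simpa using Submodule.smul_mono le_rfl le_top this
  · rw [pi_eq_sum_univ x]
    exact Submodule.sum_mem _ fun i _ ↦ Submodule.smul_mem_smul (hx i) trivial

theorem IsPrecomplete.pi {A ι : Type*} [CommRing A] [Finite ι] (I : Ideal A) [IsPrecomplete I A] :
    IsPrecomplete I (ι → A) := by
  refine ⟨fun f hf ↦ ?_⟩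
  simp only [SModEq.sub_mem, Submodule.mem_ideal_smul_top_pi, Pi.sub_apply] at hf ⊢
  choose l hl using fun i ↦ IsPrecomplete.prec (I := I) (M := A) ‹_› (f := fun n ↦ f n i)
    fun {m n} hmn ↦ by simpa [SModEq.sub_mem] using hf hmn i
  exact ⟨l, fun n i ↦ by simpa [SModEq.sub_mem] using hl i n⟩

namespace IsLocalCompletion

variable {R A : Type*} [CommRing R] [IsLocalRing R] [CommRing A] [IsLocalRing A]
    [Algebra R A] (h : IsLocalCompletion R A)

include h

theorem map_pow_eq (n : ℕ) :
    (maximalIdeal R ^ n).map (algebraMap R A) = maximalIdeal A ^ n := by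
  rw [Ideal.map_pow, h.map_eq]

variable [IsDomain R]

theorem maximalIdeal_le_of_isPrime (hdim : ringKrullDim R = 1) {a : R} (ha : a ≠ 0) (p : Ideal A)
    [p.IsPrime] (hap : algebraMap R A a ∈ p) : maximalIdeal A ≤ p := by
  rw [← h.map_eq, Ideal.map_le_iff_le_comap]
  exact maximalIdeal_le_of_isPrime_of_ne_bot hdim _ fun hp ↦ ha (by
    have : a ∈ p.comap (algebraMap R A) := hap
    simpa [hp] using this)

theorem exists_pow_le_span [IsNoetherianRing R] (hdim : ringKrullDim R = 1) {a : R} (ha : a ≠ 0) :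
    ∃ n, maximalIdeal A ^ n ≤ Ideal.span {algebraMap R A a} := by
  obtain ⟨n, hn⟩ := exists_maximalIdeal_pow_le_span hdim ha
  refine ⟨n, ?_⟩
  rw [← h.map_pow_eq, ← Set.image_singleton, ← Ideal.map_span]
  exact Ideal.map_mono hn

/-- The input to Cohen's theorem. If `P` is not maximal, it misses `b`, so `P ∩ bA = bP`. The ring
`A/bA` is a quotient of `R`, hence Noetherian; lifts to `P` of generators of the image of `P`
generate `P` modulo `bP`. Nakayama for complete modules then applies, with no finiteness assumed on
`P`: it only needs `P` to be Hausdorff, as a submodule of `A` is. -/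
theorem fg_of_isPrime [IsNoetherianRing R] (hdim : ringKrullDim R = 1)
    (P : Ideal A) [hP : P.IsPrime] : P.FG := by
  by_cases hmP : maximalIdeal A ≤ P
  · have : P = maximalIdeal A := le_antisymm (le_maximalIdeal hP.ne_top) hmP
    rw [this, ← h.map_eq]
    exact Ideal.FG.map (maximalIdeal R).fg_of_isNoetherianRing _
  obtain ⟨a, ham, ha⟩ := exists_ne_zero_mem_maximalIdeal hdim
  set b := algebraMap R A a with hb
  have hbm : b ∈ maximalIdeal A := h.map_eq ▸ Ideal.mem_map_of_mem _ ham
  have hbP : b ∉ P := fun hbP ↦ hmP (h.maximalIdeal_le_of_isPrime hdim ha P hbP)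
  obtain ⟨n, hn⟩ := h.exists_pow_le_span hdim ha
  have hsurj : Function.Surjective
      ((Ideal.Quotient.mk (Ideal.span {b})).comp (algebraMap R A)) := by
    intro y
    obtain ⟨x, rfl⟩ := Ideal.Quotient.mk_surjective y
    obtain ⟨r, hr⟩ := h.exists_sub_mem n x
    exact ⟨r, ((Ideal.Quotient.eq).2 (hn hr)).symm⟩
  have hnoeth : IsNoetherianRing (A ⧸ Ideal.span {b}) := isNoetherianRing_of_surjective _ _ _ hsurj
  obtain ⟨k, s, hs⟩ := Submodule.fg_iff_exists_fin_generating_family.1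
    ((P.map (Ideal.Quotient.mk (Ideal.span {b}))).fg_of_isNoetherianRing)
  have hlift : ∀ i, ∃ p ∈ P, Ideal.Quotient.mk (Ideal.span {b}) p = s i := fun i ↦
    (Ideal.mem_map_iff_of_surjective _ Ideal.Quotient.mk_surjective).1
      (hs ▸ Submodule.subset_span ⟨i, rfl⟩)
  choose p hpP hps using hlift
  let f : (Fin k → A) →ₗ[A] P := Fintype.linearCombination A fun i ↦ (⟨p i, hpP i⟩ : P)
  have hf : ∀ c, (f c : A) = ∑ i, c i * p i := fun c ↦ by
    simp [f, Fintype.linearCombination_apply]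
  have hcompl := h.isAdicComplete
  have hprec : IsPrecomplete (maximalIdeal A) (Fin k → A) := .pi _
  have : IsHausdorff (maximalIdeal A) P := by
    refine ⟨fun x hx ↦ Subtype.ext (hcompl.toIsHausdorff.haus (x : A) fun n ↦ ?_)⟩
    have hx := Submodule.mem_map_of_mem (f := P.subtype) (SModEq.zero.1 (hx n))
    rw [Submodule.map_smul''] at hx
    exact SModEq.zero.2 (Submodule.smul_mono le_rfl le_top hx)
  refine (Module.Finite.iff_fg).1 (Module.Finite.of_surjective f
    (surjective_of_mkQ_comp_surjective (I := maximalIdeal A) fun y ↦ ?_))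
  obtain ⟨⟨x, hx⟩, rfl⟩ := Submodule.mkQ_surjective _ y
  have hx' : Ideal.Quotient.mk (Ideal.span {b}) x ∈ Submodule.span _ (Set.range s) :=
    hs ▸ Ideal.mem_map_of_mem _ hx
  obtain ⟨c, hc⟩ := (Submodule.mem_span_range_iff_exists_fun _).1 hx'
  choose c' hc' using fun i ↦ Ideal.Quotient.mk_surjective (c i)
  have hmem : x - f c' ∈ Ideal.span {b} := by
    rw [← Ideal.Quotient.eq, hf, map_sum, ← hc]
    simp [hc', hps]
  obtain ⟨y, hy⟩ := Ideal.mem_span_singleton'.1 hmem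
  have hyP : y ∈ P := by
    refine (hP.mem_or_mem (x := y) (y := b) ?_).resolve_right hbP
    rw [hy]
    exact P.sub_mem hx (f c').2
  refine ⟨c', ?_⟩
  simp only [LinearMap.comp_apply, Submodule.mkQ_apply]
  rw [eq_comm, Submodule.Quotient.eq]
  have : (⟨x, hx⟩ : P) - f c' = b • ⟨y, hyP⟩ := Subtype.ext (by simp [← hy, mul_comm])
  rw [this]
  exact Submodule.smul_mem_smul hbm trivial

theorem isNoetherianRing [IsNoetherianRing R] (hdim : ringKrullDim R = 1) : IsNoetherianRing A :=
  .of_prime fun P _ ↦ h.fg_of_isPrime hdim P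

theorem algebraMap_mem_nonZeroDivisors {a : R} (ha : a ≠ 0) :
    algebraMap R A a ∈ nonZeroDivisors A := by
  have := h.flat
  have : IsSMulRegular A a :=
    Module.Flat.isSMulRegular_of_nonZeroDivisors (mem_nonZeroDivisors_of_ne_zero ha)
  rw [mem_nonZeroDivisors_iff_right]
  intro x hx
  refine this (?_ : a • x = a • 0)
  rw [Algebra.smul_def, mul_comm, hx, smul_zero]

variable [IsNoetherianRing A]

theorem algebraMap_notMem_of_mem_associatedPrimes {a : R} (ha : a ≠ 0) {q : Ideal A}
    (hq : q ∈ associatedPrimes A A) : algebraMap R A a ∉ q := by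
  intro haq
  have h1 : algebraMap R A a ∈ ⋃ p ∈ associatedPrimes A A, (p : Set A) :=
    Set.mem_biUnion hq haq
  rw [biUnion_associatedPrimes_eq_compl_nonZeroDivisors] at h1
  exact h1 (h.algebraMap_mem_nonZeroDivisors ha)

/-- The maximal ideal of `A` is minimal over a principal ideal, so Krull's theorem bounds its height
by one. -/
theorem mem_minimalPrimes (hdim : ringKrullDim R = 1) (q : Ideal A) [q.IsPrime]
    (hq : q ≠ maximalIdeal A) : q ∈ minimalPrimes A := by
  obtain ⟨a, ham, ha⟩ := exists_ne_zero_mem_maximalIdeal hdim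
  have hmin : maximalIdeal A ∈ (Ideal.span {algebraMap R A a}).minimalPrimes := by
    refine ⟨⟨inferInstance, ?_⟩, fun p hp _ ↦ ?_⟩
    · rw [Ideal.span_singleton_le_iff_mem, ← h.map_eq]
      exact Ideal.mem_map_of_mem _ ham
    · have := hp.1
      exact h.maximalIdeal_le_of_isPrime hdim ha p (hp.2 (Ideal.mem_span_singleton_self _))
  have hle := Ideal.height_le_one_of_isPrincipal_of_mem_minimalPrimes _ _ hmin
  have hlt : q < maximalIdeal A := lt_of_le_of_ne (le_maximalIdeal Ideal.IsPrime.ne_top') hq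
  have h0 : q.height = 0 :=
    Order.lt_one_iff.1 ((Ideal.height_strict_mono_of_isPrime hlt).trans_le hle)
  exact Ideal.mem_minimalPrimes_of_height_le bot_le (h0.trans_le zero_le)

/-- The maximal ideal contains a regular element coming from `R`, so it is not associated; every
other prime is minimal, hence associated. -/
theorem mem_associatedPrimes_iff (hdim : ringKrullDim R = 1) (q : Ideal A) [q.IsPrime] :
    q ∈ associatedPrimes A A ↔ q ≠ maximalIdeal A := by
  refine ⟨?_, fun hq ↦ ?_⟩
  · rintro hq rfl
    obtain ⟨a, ham, ha⟩ := exists_ne_zero_mem_maximalIdeal hdim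
    exact h.algebraMap_notMem_of_mem_associatedPrimes ha hq
      (h.map_eq ▸ Ideal.mem_map_of_mem _ ham)
  · refine Module.associatedPrimes.minimalPrimes_annihilator_subset_associatedPrimes A A ?_
    rw [Module.annihilator_eq_bot.2 inferInstance]
    exact h.mem_minimalPrimes hdim q hq

theorem eq_of_le_of_mem_associatedPrimes (hdim : ringKrullDim R = 1) {p q : Ideal A}
    (hp : p ∈ associatedPrimes A A) (hq : q ∈ associatedPrimes A A) (hpq : p ≤ q) : p = q := by
  have := hp.isPrime
  have := hq.isPrime
  have hmin := h.mem_minimalPrimes hdim q ((h.mem_associatedPrimes_iff hdim q).1 hq)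
  exact le_antisymm hpq (hmin.2 ⟨hp.isPrime, bot_le⟩ hpq)

/-- An ideal contained in no associated prime contains a power of the maximal ideal. -/
theorem exists_pow_le_of_not_le (hdim : ringKrullDim R = 1) (J : Ideal A)
    (hJ : ∀ q ∈ associatedPrimes A A, ¬ J ≤ q) : ∃ n, maximalIdeal A ^ n ≤ J := by
  refine exists_maximalIdeal_pow_le J fun p hp hJp ↦ ?_
  by_contra hm
  exact hJ p ((h.mem_associatedPrimes_iff hdim p).2 fun h ↦ hm h.ge) hJp

end IsLocalCompletion

/-! ### The action of the completion on the injective hull -/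

theorem exists_maximalIdeal_pow_smul_eq_zero {A E : Type*} [CommRing A] [IsLocalRing A]
    [IsNoetherianRing A] [AddCommGroup E] [Module A E] (f : (A ⧸ maximalIdeal A) →ₗ[A] E)
    (hf : ∀ N : Submodule A E, N ⊓ LinearMap.range f = ⊥ → N = ⊥) (e : E) :
    ∃ n, ∀ x ∈ maximalIdeal A ^ n, x • e = 0 := by
  let φ : A →ₗ[A] E := LinearMap.toSpanSingleton A E e
  obtain ⟨n, hn⟩ : ∃ n, maximalIdeal A ^ n ≤ (LinearMap.ker φ : Ideal A) := by
    refine exists_maximalIdeal_pow_le _ fun p hp hJp ↦ ?_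
    obtain ⟨q, hq, hqp⟩ := Ideal.exists_minimalPrimes_le hJp
    refine le_trans ?_ hqp
    have hqA : q ∈ associatedPrimes A (A ⧸ (LinearMap.ker φ : Ideal A)) :=
      Module.associatedPrimes.minimalPrimes_annihilator_subset_associatedPrimes A _
        (by rwa [Ideal.annihilator_quotient])
    have hqE : IsAssociatedPrime q E := hqA.map_of_injective
      ((LinearMap.ker φ).liftQ φ le_rfl) (LinearMap.ker_eq_bot.1 (by
        rw [Submodule.ker_liftQ, Submodule.mkQ_map_self]))
    obtain ⟨hqp, x, hx⟩ := isAssociatedPrime_iff.1 hqE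
    have hqx : ∀ r, r ∈ q ↔ r • x = 0 := fun r ↦ by
      rw [hx, Submodule.mem_colon_singleton, Submodule.mem_bot]
    intro t ht
    by_contra htq
    have hx0 : x ≠ 0 := fun h0 ↦ hqp.ne_top ((Ideal.eq_top_iff_one _).2 ((hqx 1).2 (by simp [h0])))
    -- Here `q` is the annihilator of `x`, and `t` is in the maximal ideal but not in `q`. A
    -- multiple `r • x` in the range of `f` is killed by `t`, so `t * r ∈ q` and `r ∈ q`. Thus the
    -- span of `x` misses the range, against essentiality.
    refine hx0 (Submodule.span_singleton_eq_bot.1 (hf (A ∙ x) ((Submodule.eq_bot_iff _).2 ?_)))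
    rintro _ ⟨h1, k, rfl⟩
    obtain ⟨r, hr⟩ := Submodule.mem_span_singleton.1 h1
    rw [← hr]
    refine (hqx r).1 ((hqp.mem_or_mem ((hqx (t * r)).2 ?_)).resolve_left htq)
    obtain ⟨k, rfl⟩ := Ideal.Quotient.mk_surjective k
    rw [mul_smul, hr, ← map_smul]
    have : t • (Ideal.Quotient.mk (maximalIdeal A)) k = 0 := by
      rw [← Ideal.Quotient.mk_eq_mk, ← Submodule.Quotient.mk_smul, Submodule.Quotient.mk_eq_zero]
      exact Ideal.mul_mem_right _ _ ht
    rw [this, map_zero]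
  exact ⟨n, fun x hx ↦ hn hx⟩

section TorsionModule

variable {R E : Type*} [CommRing R] (I : Ideal R) [AddCommGroup E] [Module R E]
  (hE : ∀ e : E, ∃ n, ∀ x ∈ I ^ n, x • e = 0)

-- A completed scalar acts on `e` through any representative modulo a power of `I` killing `e`; two
-- levels are compared at their maximum. Allowing every level in the conclusion lets the module
-- axioms be checked in `R`, at one level that suits all elements involved.
include hE in
theorem exists_adicCompletion_smul : ∃ g : AdicCompletion I R → E → E, ∀ x e n r,
    (∀ y ∈ I ^ n, y • e = 0) → x.val n = Submodule.Quotient.mk r → g x e = r • e := by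
  choose n hn using hE
  choose r hr using fun (x : AdicCompletion I R) (e : E) ↦
    Submodule.Quotient.mk_surjective _ (x.val (n e))
  refine ⟨fun x e ↦ r x e • e, fun x e k s hk hs ↦ ?_⟩
  obtain ⟨t, ht⟩ := Submodule.Quotient.mk_surjective _ (x.val (max (n e) k))
  have key : ∀ j r', j ≤ max (n e) k → (∀ y ∈ I ^ j, y • e = 0) →
      x.val j = Submodule.Quotient.mk r' → r' • e = t • e := by
    intro j r' hj hy hr'
    have h1 := AdicCompletion.transitionMap_comp_eval_apply I R hj x
    change AdicCompletion.transitionMap I R hj (x.val _) = x.val j at h1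
    rw [← ht, hr'] at h1
    have h2 : t - r' ∈ (I ^ j • ⊤ : Ideal R) := (Submodule.Quotient.eq _).1 h1
    rw [smul_eq_mul, Ideal.mul_top] at h2
    have := hy _ h2
    rwa [sub_smul, sub_eq_zero, eq_comm] at this
  beta_reduce
  rw [key _ _ (le_max_left _ _) (hn e) (hr x e).symm, key _ _ (le_max_right _ _) hk hs]

include hE in
theorem exists_module_adicCompletion :
    ∃ _ : Module (AdicCompletion I R) E, IsScalarTower R (AdicCompletion I R) E := by
  obtain ⟨g, hg⟩ := exists_adicCompletion_smul I hE
  have hle : ∀ {m n : ℕ} {e : E}, m ≤ n → (∀ y ∈ I ^ m, y • e = 0) → ∀ y ∈ I ^ n, y • e = 0 :=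
    fun hmn h y hy ↦ h y (Ideal.pow_le_pow_right hmn hy)
  have hrep : ∀ (x : AdicCompletion I R) n, ∃ r : R, x.val n = Submodule.Quotient.mk r := fun x n ↦
    (Submodule.Quotient.mk_surjective _ (x.val n)).imp fun _ h ↦ h.symm
  let M : Module (AdicCompletion I R) E :=
    { smul := g
      one_smul := fun e ↦ by
        obtain ⟨n, hn⟩ := hE e
        exact (hg 1 e n 1 hn rfl).trans (one_smul _ _)
      mul_smul := fun x y e ↦ by
        obtain ⟨n, hn⟩ := hE e
        obtain ⟨r, hr⟩ := hrep x n
        obtain ⟨s, hs⟩ := hrep y n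
        change g (x * y) e = g x (g y e)
        rw [hg (x * y) e n (r * s) hn (by rw [AdicCompletion.val_mul, hr, hs]; rfl),
          hg y e n s hn hs, hg x (s • e) n r
            (fun t ht ↦ by rw [smul_comm, hn t ht, smul_zero]) hr, mul_smul]
      smul_zero := fun x ↦ by
        obtain ⟨r, hr⟩ := hrep x 0
        exact (hg x 0 0 r (by simp) hr).trans (smul_zero _)
      smul_add := fun x e e' ↦ by
        obtain ⟨n, hn⟩ := hE e
        obtain ⟨k, hk⟩ := hE e'
        obtain ⟨r, hr⟩ := hrep x (max n k)
        have h1 := hle (le_max_left n k) hn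
        have h2 := hle (le_max_right n k) hk
        change g x (e + e') = g x e + g x e'
        rw [hg x _ _ r h1 hr, hg x _ _ r h2 hr,
          hg x _ _ r (fun y hy ↦ by rw [smul_add, h1 y hy, h2 y hy, add_zero]) hr, smul_add]
      add_smul := fun x y e ↦ by
        obtain ⟨n, hn⟩ := hE e
        obtain ⟨r, hr⟩ := hrep x n
        obtain ⟨s, hs⟩ := hrep y n
        change g (x + y) e = g x e + g y e
        rw [hg (x + y) e n (r + s) hn (by rw [AdicCompletion.val_add_apply, hr, hs]; rfl),
          hg x e n r hn hr, hg y e n s hn hs, add_smul]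
      zero_smul := fun e ↦ by
        obtain ⟨n, hn⟩ := hE e
        exact (hg 0 e n 0 hn rfl).trans (zero_smul _ _) }
  refine ⟨M, ⟨fun r x e ↦ ?_⟩⟩
  obtain ⟨n, hn⟩ := hE e
  obtain ⟨s, hs⟩ := hrep x n
  change g (r • x) e = r • g x e
  rw [hg x e n s hn hs, hg (r • x) e n (r * s) hn
    (by rw [AdicCompletion.val_smul_apply, hs]; rfl), mul_smul]

end TorsionModule

/-! ### Injectivity over the completion -/

namespace IsLocalCompletion

section

variable {R A E : Type*} [CommRing R] [IsLocalRing R] [CommRing A] [IsLocalRing A]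
  [Algebra R A] (h : IsLocalCompletion R A) [AddCommGroup E] [Module R E] [Module A E]
  [IsScalarTower R A E]

include h

theorem smul_eq_zero_of_mem_pow {n : ℕ} {e : E} (he : ∀ x ∈ maximalIdeal R ^ n, x • e = 0)
    {x : A} (hx : x ∈ maximalIdeal A ^ n) : x • e = 0 := by
  have hle : (maximalIdeal R ^ n).map (algebraMap R A) ≤
      LinearMap.ker (LinearMap.toSpanSingleton A E e) := by
    rw [Ideal.map_le_iff_le_comap]
    intro y hy
    simpa using he y hy
  rw [h.map_pow_eq] at hle
  exact hle hx

end

/-- A map from an ideal to `E` factors through a quotient of finite level, where `R`-linear and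
`A`-linear maps agree, so injectivity over `R` suffices. -/
theorem baer {R A E : Type u} [CommRing R] [IsLocalRing R] [CommRing A] [IsLocalRing A]
    [IsNoetherianRing A] [Algebra R A] (h : IsLocalCompletion R A) [AddCommGroup E] [Module R E]
    [Module A E] [IsScalarTower R A E] (hinj : Module.Injective R E)
    (hE : ∀ e : E, ∃ n, ∀ x ∈ maximalIdeal R ^ n, x • e = 0) : Module.Baer A E := by
  intro I g
  obtain ⟨n, hn⟩ : ∃ n, ∀ y, ∀ t ∈ maximalIdeal A ^ n, t • g y = 0 := by
    obtain ⟨k, s, hs⟩ := Submodule.fg_iff_exists_fin_generating_family.1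
      (Module.Finite.fg_top (R := A) (M := I))
    choose n hn using fun i ↦ hE (g (s i))
    refine ⟨∑ i, n i, fun y t ht ↦ ?_⟩
    have hy : y ∈ Submodule.span A (Set.range s) := hs ▸ trivial
    induction hy using Submodule.span_induction with
    | mem y hy =>
      obtain ⟨i, rfl⟩ := hy
      exact h.smul_eq_zero_of_mem_pow (hn i) (Ideal.pow_le_pow_right
        (Finset.single_le_sum (fun _ _ ↦ Nat.zero_le _) (Finset.mem_univ i)) ht)
    | zero => simp
    | add y z _ _ hy hz => rw [map_add, smul_add, hy, hz, add_zero]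
    | smul r y _ hy => rw [map_smul, smul_comm, hy, smul_zero]
  -- Artin–Rees: the part of `I` inside the power `n + k` of the maximal ideal lies in the `n`-th
  -- power times `I`, which `g` kills.
  obtain ⟨k, hk⟩ := Ideal.exists_pow_inf_eq_pow_smul (maximalIdeal A) I
  set J := maximalIdeal A ^ (n + k) with hJ
  have hker : ∀ y : I, (y : A) ∈ J → g y = 0 := by
    intro y hy
    have h1 := hk (n + k) (Nat.le_add_left _ _)
    rw [Nat.add_sub_cancel, smul_eq_mul, Ideal.mul_top] at h1
    have h2 : (y : A) ∈ maximalIdeal A ^ n • I :=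
      Submodule.smul_mono le_rfl inf_le_right (h1.le ⟨hy, y.2⟩)
    have h3 : y ∈ (maximalIdeal A ^ n • ⊤ : Submodule A I) := by
      have h4 : (maximalIdeal A ^ n • ⊤ : Submodule A I).map I.subtype =
          maximalIdeal A ^ n • I := by
        rw [Submodule.map_smul'', Submodule.map_subtype_top]
      obtain ⟨z, hz, hzy⟩ := h4.ge h2
      rwa [← Subtype.ext hzy]
    refine Submodule.smul_induction_on (p := fun y ↦ g y = 0) h3 (fun t ht z _ ↦ ?_)
      fun y z hy hz ↦ ?_
    · rw [map_smul, hn z t ht]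
    · rw [map_add, hy, hz, add_zero]
  let φ : I →ₗ[A] A ⧸ J := J.mkQ ∘ₗ I.subtype
  have hφ : LinearMap.ker φ ≤ LinearMap.ker g := fun y hy ↦
    hker y ((Submodule.Quotient.mk_eq_zero J).1 hy)
  obtain ⟨e, he⟩ := hinj.out
    (((LinearMap.ker φ).liftQ φ le_rfl).restrictScalars R)
    (LinearMap.ker_eq_bot.1 (by
      rw [LinearMap.ker_restrictScalars, Submodule.ker_liftQ, Submodule.mkQ_map_self]; rfl))
    (((LinearMap.ker φ).liftQ g hφ).restrictScalars R)
  have hkill : ∀ z, ∀ t ∈ maximalIdeal R ^ (n + k), t • e z = 0 := by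
    intro z t ht
    obtain ⟨z, rfl⟩ := Submodule.Quotient.mk_surjective _ z
    rw [← map_smul, ← Submodule.Quotient.mk_smul,
      (Submodule.Quotient.mk_eq_zero J).2, map_zero]
    rw [Algebra.smul_def]
    refine J.mul_mem_right _ ?_
    rw [hJ, ← h.map_pow_eq]
    exact Ideal.mem_map_of_mem _ ht
  refine ⟨{ toFun := fun x ↦ e (Submodule.Quotient.mk x)
            map_add' := fun x y ↦ by rw [Submodule.Quotient.mk_add, map_add]
            map_smul' := fun a x ↦ ?_ }, fun x hx ↦ ?_⟩
  -- The extension `e` is only `R`-linear, but `a` and its approximation `r` act alike on `A ⧸ J`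
  -- and on the values of `e`.
  · obtain ⟨r, hr⟩ := h.exists_sub_mem (n + k) a
    have h1 : (Submodule.Quotient.mk (a • x) : A ⧸ J) = r • Submodule.Quotient.mk x := by
      rw [← Submodule.Quotient.mk_smul, Submodule.Quotient.eq, Algebra.smul_def (R := R),
        smul_eq_mul, ← sub_mul]
      exact J.mul_mem_right _ hr
    rw [h1, map_smul, RingHom.id_apply, eq_comm, ← sub_eq_zero, ← algebraMap_smul A r, ← sub_smul]
    exact h.smul_eq_zero_of_mem_pow (hkill _) hr
  · exact he (Submodule.Quotient.mk ⟨x, hx⟩)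

end IsLocalCompletion

/-! ### Lengths, Matlis duality and Chevalley's theorem -/

theorem isArtinianRing_quotient_of_maximalIdeal_pow_le {A : Type*} [CommRing A] [IsLocalRing A]
    [IsNoetherianRing A] {J : Ideal A} {n : ℕ} (hJ : maximalIdeal A ^ n ≤ J) :
    IsArtinianRing (A ⧸ J) := by
  rw [isArtinianRing_iff_isNoetherianRing_krullDimLE_zero]
  refine ⟨inferInstance, .mk₀ fun p hp ↦ ?_⟩
  have hle : maximalIdeal A ≤ p.comap (Ideal.Quotient.mk J) := by
    refine Ideal.IsPrime.le_of_pow_le (n := n) (hJ.trans fun x hx ↦ ?_)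
    rw [Ideal.mem_comap, Ideal.Quotient.eq_zero_iff_mem.2 hx]
    exact p.zero_mem
  have hmax : (p.comap (Ideal.Quotient.mk J)).IsMaximal := by
    rw [← (maximalIdeal.isMaximal A).eq_of_le (Ideal.IsPrime.ne_top inferInstance) hle]
    infer_instance
  rw [← Ideal.map_comap_of_surjective _ Ideal.Quotient.mk_surjective p]
  exact Ideal.IsMaximal.map_of_surjective_of_ker_le Ideal.Quotient.mk_surjective
    (Ideal.ker_le_comap _)

theorem Module.length_le_add_of_ker_le_range {R X Y Z : Type*} [Ring R] [AddCommGroup X]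
    [AddCommGroup Y] [AddCommGroup Z] [Module R X] [Module R Y] [Module R Z] (f : X →ₗ[R] Y)
    (g : Y →ₗ[R] Z) (hfg : LinearMap.ker g ≤ LinearMap.range f) :
    Module.length R Y ≤ Module.length R X + Module.length R Z := by
  rw [Module.length_eq_add_of_exact (LinearMap.ker g).subtype g.rangeRestrict
    Subtype.val_injective g.surjective_rangeRestrict
    (LinearMap.exact_iff.2 (by rw [LinearMap.ker_rangeRestrict, Submodule.range_subtype]))]
  refine add_le_add ?_ (Module.length_le_of_injective _ (LinearMap.range g).subtype_injective)
  exact (Module.length_le_of_injective _ (Submodule.inclusion_injective hfg)).trans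
    (Module.length_le_of_surjective _ f.surjective_rangeRestrict)

section Hull

variable {R E : Type u} [CommRing R] [IsLocalRing R] [AddCommGroup E] [Module R E]
  (hE : IsInjectiveHull R (R ⧸ maximalIdeal R) E)

include hE

theorem IsInjectiveHull.exists_pow_smul_eq_zero [IsNoetherianRing R] (e : E) :
    ∃ n, ∀ x ∈ maximalIdeal R ^ n, x • e = 0 := by
  obtain ⟨-, f, -, hf⟩ := hE
  exact exists_maximalIdeal_pow_smul_eq_zero f hf e

/-- A map from the residue field is determined by the image of `1`, which lies in the socle of `E`.
By essentiality the socle is contained in the embedded residue field. -/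
theorem IsInjectiveHull.length_linearMap_le_one (X : Type*) [AddCommGroup X] [Module R X]
    [IsSimpleModule R X] : Module.length R (X →ₗ[R] E) ≤ 1 := by
  obtain ⟨-, f, hfinj, hf⟩ := hE
  obtain ⟨I, hI, ⟨e⟩⟩ := isSimpleModule_iff_quot_maximal.1 ‹IsSimpleModule R X›
  obtain rfl := eq_maximalIdeal hI
  have hsoc : ∀ z : E, (∀ t ∈ maximalIdeal R, t • z = 0) → z ∈ LinearMap.range f := by
    intro z hz
    by_contra hzf
    have hz0 : z = 0 := by
      refine Submodule.span_singleton_eq_bot.1 (hf (R ∙ z) ((Submodule.eq_bot_iff _).2 ?_))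
      rintro y ⟨h1, h2⟩
      obtain ⟨r, rfl⟩ := Submodule.mem_span_singleton.1 h1
      by_cases hr : r ∈ maximalIdeal R
      · exact hz r hr
      · have hu : IsUnit r := by simpa using hr
        exact (hzf ((Submodule.smul_mem_iff_of_isUnit _ hu).1 h2)).elim
    exact hzf (hz0 ▸ zero_mem _)
  let ev : (X →ₗ[R] E) →ₗ[R] E := LinearMap.applyₗ (e.symm 1)
  have hev : Function.Injective ev := by
    intro φ ψ hφψ
    have hc : φ ∘ₗ e.symm.toLinearMap = ψ ∘ₗ e.symm.toLinearMap := by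
      refine Submodule.linearMap_qext _ (LinearMap.ext_ring hφψ)
    ext x
    simpa using LinearMap.congr_fun hc (e x)
  have hrange : ∀ φ, ev φ ∈ LinearMap.range f := fun φ ↦ hsoc _ fun t ht ↦ by
    change t • φ (e.symm 1) = 0
    rw [← map_smul, ← map_smul]
    have : t • (1 : R ⧸ maximalIdeal R) = 0 := by
      rw [Algebra.smul_def, mul_one]
      exact Ideal.Quotient.eq_zero_iff_mem.2 ht
    rw [this, map_zero, map_zero]
  have hsimple : IsSimpleModule R (R ⧸ maximalIdeal R) := IsSimpleModule.congr e.symm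
  calc Module.length R (X →ₗ[R] E) ≤ Module.length R (LinearMap.range f) :=
        Module.length_le_of_injective (ev.codRestrict _ hrange)
          fun a b hab ↦ hev (congrArg Subtype.val hab)
    _ = Module.length R (R ⧸ maximalIdeal R) := (LinearEquiv.ofInjective f hfinj).symm.length_eq
    _ = 1 := Module.length_eq_one _ _
    _ ≤ 1 := le_rfl

theorem IsInjectiveHull.length_linearMap_le {X : Type*} [AddCommGroup X] [Module R X]
    (hX : IsFiniteLength R X) : Module.length R (X →ₗ[R] E) ≤ Module.length R X := by
  induction hX with
  | of_subsingleton => rw [Module.length_eq_zero]; exact zero_le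
  | @of_simple_quotient M _ _ N _ _ ih =>
    calc Module.length R (M →ₗ[R] E)
        ≤ Module.length R ((M ⧸ N) →ₗ[R] E) + Module.length R (N →ₗ[R] E) := by
          refine Module.length_le_add_of_ker_le_range (N.mkQ.lcomp R E) (N.subtype.lcomp R E)
            fun φ hφ ↦ ⟨N.liftQ φ fun x hx ↦ LinearMap.congr_fun hφ ⟨x, hx⟩, ?_⟩
          ext x
          rfl
      _ ≤ Module.length R (M ⧸ N) + Module.length R N :=
          add_le_add ((length_linearMap_le_one hE _).trans_eq (Module.length_eq_one _ _).symm) ih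
      _ = Module.length R M := by
          rw [add_comm, ← Module.length_eq_add_of_exact N.subtype N.mkQ N.subtype_injective
            N.mkQ_surjective (LinearMap.exact_subtype_mkQ N)]

/-- Sending `e` to `x ↦ x • e` embeds `N` in the Matlis dual of `A ⧸ J`. -/
theorem IsInjectiveHull.length_le_of_smul_eq_zero {A : Type*} [CommRing A] [Algebra R A]
    [Module A E] [IsScalarTower R A E] (J : Ideal A) (hJ : IsFiniteLength R (A ⧸ J))
    (N : Submodule R E) (hN : ∀ x ∈ J, ∀ e ∈ N, x • e = 0) :
    Module.length R N ≤ Module.length R (A ⧸ J) := by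
  let t : N → (A ⧸ J) →ₗ[R] E := fun e ↦ LinearMap.restrictScalars R
    (Submodule.liftQ J (LinearMap.toSpanSingleton A E (e : E)) fun x hx ↦ hN x hx e e.2)
  have ht : ∀ e x, t e (Submodule.Quotient.mk x) = x • (e : E) := fun e x ↦ rfl
  let T : N →ₗ[R] ((A ⧸ J) →ₗ[R] E) :=
    { toFun := t
      map_add' := fun e e' ↦ LinearMap.ext fun x ↦ by
        obtain ⟨x, rfl⟩ := Submodule.Quotient.mk_surjective _ x
        rw [LinearMap.add_apply, ht, ht, ht, Submodule.coe_add, smul_add]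
      map_smul' := fun r e ↦ LinearMap.ext fun x ↦ by
        obtain ⟨x, rfl⟩ := Submodule.Quotient.mk_surjective _ x
        rw [LinearMap.smul_apply, ht, ht, RingHom.id_apply, Submodule.coe_smul, smul_comm] }
  refine (Module.length_le_of_injective T fun e e' hee ↦ Subtype.ext ?_).trans
    (hE.length_linearMap_le hJ)
  have h1 : t e (Submodule.Quotient.mk 1) = t e' (Submodule.Quotient.mk 1) :=
    LinearMap.congr_fun hee _
  rwa [ht, ht, one_smul, one_smul] at h1

end Hull

/-- Chevalley's theorem on decreasing sequences of open submodules of a complete module. -/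
theorem exists_le_of_antitone {A M : Type*} [CommRing A] [AddCommGroup M] [Module A M]
    (I : Ideal A) [IsPrecomplete I M] (hart : ∀ k, IsArtinian A (M ⧸ (I ^ k • ⊤ : Submodule A M)))
    (L : ℕ → Submodule A M) (hL : Antitone L)
    (hIL : ∀ n, ∃ e, (I ^ e • ⊤ : Submodule A M) ≤ L n) (W : Submodule A M) (k₀ : ℕ)
    (hW : (I ^ k₀ • ⊤ : Submodule A M) ≤ W) (hinf : ⨅ n, L n ≤ W) : ∃ N, L N ≤ W := by
  let T : ℕ → Submodule A M := fun k ↦ I ^ k • ⊤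
  have hT : Antitone T := fun i j hij ↦ Submodule.smul_mono (Ideal.pow_le_pow_right hij) le_rfl
  -- The images of the `L n` in the Artinian quotient by `T k` stabilise.
  have hstab : ∀ k, ∃ n, ∀ j, n ≤ j → L n ≤ L j ⊔ T k := by
    intro k
    have := hart k
    obtain ⟨n, hn⟩ := IsArtinian.monotone_stabilizes (R := A) (M := M ⧸ T k)
      ⟨fun n ↦ OrderDual.toDual ((L n).map (T k).mkQ), fun i j hij ↦ Submodule.map_mono (hL hij)⟩
    refine ⟨n, fun j hj x hx ↦ ?_⟩
    have h1 : (L n).map (T k).mkQ = (L j).map (T k).mkQ := hn j hj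
    obtain ⟨y, hy, hyx⟩ := h1.le (Submodule.mem_map_of_mem hx)
    have h2 : x - y ∈ T k := (Submodule.Quotient.eq _).1 hyx.symm
    rw [← add_sub_cancel y x]
    exact Submodule.add_mem_sup hy h2
  choose n hn using hstab
  have hn' : ∀ k j, L (n k) ≤ L j ⊔ T k := fun k j ↦ (le_total (n k) j).elim (hn k j)
    fun h ↦ (hL h).trans le_sup_left
  -- From a point of `L (n k₀)` outside `W`, stability gives a Cauchy sequence with terms in ever
  -- smaller `L`. Its limit lies in every `L j`, since each is open, hence in `W`; yet it differs
  -- from the starting point by an element of `T k₀ ≤ W`.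
  by_contra! hcon
  obtain ⟨x₀, hx₀, hx₀W⟩ := SetLike.not_le_iff_exists.1 (hcon (n k₀))
  have hstep : ∀ k, ∀ x : L (n k), ∃ y : L (n (k + 1)), (x - y : M) ∈ T k := by
    rintro k ⟨x, hx⟩
    obtain ⟨y, hy, t, ht, rfl⟩ := Submodule.mem_sup.1 (hn' k (n (k + 1)) hx)
    exact ⟨⟨y, hy⟩, by simpa using ht⟩
  choose s hs using hstep
  obtain ⟨z, hz0, hz⟩ : ∃ z : ∀ i, L (n (k₀ + i)), (z 0 : M) = x₀ ∧
      ∀ i, (z i : M) - (z (i + 1) : M) ∈ T (k₀ + i) := by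
    let z : ∀ i, L (n (k₀ + i)) :=
      fun i ↦ Nat.rec (motive := fun i ↦ L (n (k₀ + i))) ⟨x₀, hx₀⟩ (fun i x ↦ s (k₀ + i) x) i
    exact ⟨z, rfl, fun i ↦ hs (k₀ + i) (z i)⟩
  have hz' : ∀ i j, i ≤ j → ((z i : M) - z j) ∈ T (k₀ + i) := by
    intro i j hij
    induction j, hij using Nat.le_induction with
    | base => simp
    | succ j hij ih =>
      have := (T (k₀ + i)).add_mem ih (hT (Nat.add_le_add_left hij k₀) (hz j))
      rwa [sub_add_sub_cancel] at this
  obtain ⟨l, hl⟩ := IsPrecomplete.prec (I := I) (M := M) ‹_› (f := fun i ↦ (z i : M))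
    fun {i j} hij ↦ (SModEq.sub_mem).2 (hT (Nat.le_add_left _ _) (hz' i j hij))
  -- Convergence alone gives only `T i`; passing through the term of index `k₀ + i` recovers the
  -- shift.
  have hl' : ∀ i, ((z i : M) - l) ∈ T (k₀ + i) := fun i ↦ by
    have h1 := hz' i (k₀ + i) (Nat.le_add_left _ _)
    have h2 : (z (k₀ + i) - l : M) ∈ T (k₀ + i) := (SModEq.sub_mem).1 (hl (k₀ + i))
    have := (T (k₀ + i)).add_mem h1 h2
    rwa [sub_add_sub_cancel] at this
  have hlL : ∀ j, l ∈ L j := by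
    intro j
    obtain ⟨e, he⟩ := hIL j
    have h1 : T (k₀ + e) ≤ L j := (hT (Nat.le_add_left _ _)).trans he
    have h2 : (z e : M) ∈ L j := by
      have := hn' (k₀ + e) j (z e).2
      rwa [sup_eq_left.2 h1] at this
    have := (L j).sub_mem h2 (h1 (hl' e))
    rwa [sub_sub_cancel] at this
  have h3 : l ∈ W := hinf ((Submodule.mem_iInf _).2 hlL)
  have h4 : x₀ - l ∈ W := hz0 ▸ hW (hl' 0)
  exact hx₀W ((Submodule.sub_mem_iff_left _ h3).1 h4)

/-! ### Length growth modulo `q` and multiplicity one -/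

section Length

variable (R : Type*) {A : Type*} [CommRing R] [CommRing A] [Algebra R A] (b : A) (q : Ideal A)

/-- Multiplication by `b ^ n` maps the first quotient on the right onto the kernel of the projection
to the second. -/
theorem length_quotient_pow_sup_add_le (n k : ℕ) :
    Module.length R (A ⧸ (Ideal.span {b ^ (n + k)} ⊔ q)) ≤
      Module.length R (A ⧸ (Ideal.span {b ^ k} ⊔ q)) +
        Module.length R (A ⧸ (Ideal.span {b ^ n} ⊔ q)) := by
  have hle : Ideal.span {b ^ (n + k)} ⊔ q ≤ Ideal.span {b ^ n} ⊔ q :=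
    sup_le_sup_right
      (Ideal.span_singleton_le_span_singleton.2 (pow_dvd_pow b (Nat.le_add_right _ _))) q
  have hmul : Ideal.span {b ^ k} ⊔ q ≤
      Submodule.comap (LinearMap.mulLeft A (b ^ n)) (Ideal.span {b ^ (n + k)} ⊔ q) := by
    refine sup_le ((Ideal.span_singleton_le_iff_mem _).2 ?_) fun x hx ↦ ?_
    · refine Ideal.mem_sup_left (Ideal.mem_span_singleton.2 ?_)
      rw [LinearMap.mulLeft_apply, pow_add]
    · exact Ideal.mem_sup_right (q.mul_mem_left _ hx)
  let f : A ⧸ (Ideal.span {b ^ k} ⊔ q) →ₗ[A] A ⧸ (Ideal.span {b ^ (n + k)} ⊔ q) :=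
    Submodule.mapQ _ _ (LinearMap.mulLeft A (b ^ n)) hmul
  let g : A ⧸ (Ideal.span {b ^ (n + k)} ⊔ q) →ₗ[A] A ⧸ (Ideal.span {b ^ n} ⊔ q) :=
    Submodule.factor hle
  refine Module.length_le_add_of_ker_le_range (f.restrictScalars R) (g.restrictScalars R) ?_
  intro x hx
  obtain ⟨x, rfl⟩ := Submodule.Quotient.mk_surjective _ x
  have hx' : x ∈ Ideal.span {b ^ n} ⊔ q := (Submodule.Quotient.mk_eq_zero _).1 hx
  obtain ⟨y, hy, w, hw, rfl⟩ := Submodule.mem_sup.1 hx'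
  obtain ⟨y, rfl⟩ := Ideal.mem_span_singleton.1 hy
  refine ⟨Submodule.Quotient.mk y, (Submodule.Quotient.eq _).2 ?_⟩
  rw [LinearMap.mulLeft_apply, sub_add_cancel_left]
  exact Ideal.mem_sup_right (q.neg_mem hw)

/-- Each step adds at least one: were the class of `b ^ n` zero at level `n + 1`, then `b ^ n` times
a unit `1 - b * y` would lie in `q`. -/
theorem le_length_quotient_pow_sup [IsLocalRing A] [q.IsPrime] (hb : b ∈ maximalIdeal A)
    (hbq : b ∉ q) (n : ℕ) : (n : ℕ∞) ≤ Module.length R (A ⧸ (Ideal.span {b ^ n} ⊔ q)) := by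
  induction n with
  | zero => simp
  | succ n ih =>
    have hle : Ideal.span {b ^ (n + 1)} ⊔ q ≤ Ideal.span {b ^ n} ⊔ q :=
      sup_le_sup_right
        (Ideal.span_singleton_le_span_singleton.2 (pow_dvd_pow b (Nat.le_succ _))) q
    let g : A ⧸ (Ideal.span {b ^ (n + 1)} ⊔ q) →ₗ[R] A ⧸ (Ideal.span {b ^ n} ⊔ q) :=
      (Submodule.factor hle).restrictScalars R
    have hg : Function.Surjective g := Submodule.factor_surjective hle
    have hker : Nontrivial (LinearMap.ker g) := by
      refine Submodule.nontrivial_iff_ne_bot.2 fun hbot ↦ ?_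
      have h1 : (Submodule.Quotient.mk (b ^ n) : A ⧸ (Ideal.span {b ^ (n + 1)} ⊔ q)) ∈
          LinearMap.ker g :=
        (Submodule.Quotient.mk_eq_zero _).2 (Ideal.mem_sup_left (Ideal.mem_span_singleton_self _))
      rw [hbot, Submodule.mem_bot, Submodule.Quotient.mk_eq_zero] at h1
      obtain ⟨y, hy, w, hw, hyw⟩ := Submodule.mem_sup.1 h1
      obtain ⟨y, rfl⟩ := Ideal.mem_span_singleton.1 hy
      have h2 : b ^ n * (1 - b * y) ∈ q := by
        have : b ^ n * (1 - b * y) = w := by linear_combination -hyw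
        rwa [this]
      have hu : IsUnit (1 - b * y) := by
        have : b * y ∈ maximalIdeal A := Ideal.mul_mem_right _ _ hb
        exact IsLocalRing.isUnit_one_sub_self_of_mem_nonunits _ this
      rw [Ideal.mul_unit_mem_iff_mem _ hu] at h2
      exact hbq (‹q.IsPrime›.mem_of_pow_mem n h2)
    rw [Module.length_eq_add_of_exact (LinearMap.ker g).subtype g
      Subtype.val_injective hg (LinearMap.exact_subtype_ker_map g), add_comm (Module.length _ _)]
    push_cast
    exact add_le_add ih (Order.one_le_iff_pos.2 Module.length_pos)

end Length

theorem isArtinian_quotient_pow_smul_top_pi {A : Type*} [CommRing A] [IsLocalRing A]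
    [IsNoetherianRing A] (ι : Type*) [Finite ι] (k : ℕ) :
    IsArtinian A ((ι → A) ⧸ (maximalIdeal A ^ k • ⊤ : Submodule A (ι → A))) := by
  have := isArtinianRing_quotient_of_maximalIdeal_pow_le (le_refl (maximalIdeal A ^ k))
  have : IsArtinian A (A ⧸ maximalIdeal A ^ k) :=
    isArtinian_of_surjective_algebraMap (R := A ⧸ maximalIdeal A ^ k) Ideal.Quotient.mk_surjective
  let f : (ι → A) →ₗ[A] ι → A ⧸ maximalIdeal A ^ k :=
    LinearMap.pi fun i ↦ (Submodule.mkQ (maximalIdeal A ^ k)) ∘ₗ LinearMap.proj i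
  have hf : ∀ x, f x = 0 ↔ ∀ i, x i ∈ maximalIdeal A ^ k := fun x ↦ by
    rw [funext_iff]
    exact forall_congr' fun i ↦ Submodule.Quotient.mk_eq_zero _
  have hker : (maximalIdeal A ^ k • ⊤ : Submodule A (ι → A)) = LinearMap.ker f :=
    Submodule.ext fun x ↦ (Submodule.mem_ideal_smul_top_pi _ x).trans (hf x).symm
  rw [hker]
  exact isArtinian_of_injective _
    (LinearMap.ker_eq_bot.1 (Submodule.ker_liftQ_eq_bot _ f le_rfl le_rfl))

/-- Every nonzero `s` divides a power of `a`, because its ideal contains a power of the maximal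
ideal. -/
theorem IsFractionRing.exists_smul_inv_pow {R Q : Type*} [CommRing R] [IsDomain R] [IsLocalRing R]
    [IsNoetherianRing R] (hdim : ringKrullDim R = 1) [Field Q] [Algebra R Q] [IsFractionRing R Q]
    {a : R} (ham : a ∈ maximalIdeal R) (ha : a ≠ 0) (y : Q) :
    ∃ (r : R) (n : ℕ), y = r • (algebraMap R Q a)⁻¹ ^ n := by
  obtain ⟨r, s, hs, rfl⟩ := IsFractionRing.div_surjective (A := R) y
  have hs0 : s ≠ 0 := nonZeroDivisors.ne_zero hs
  obtain ⟨n, hn⟩ := exists_maximalIdeal_pow_le_span hdim hs0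
  obtain ⟨t, ht⟩ := Ideal.mem_span_singleton.1 (hn (Ideal.pow_mem_pow ham n))
  have hinj := IsFractionRing.injective R Q
  have h1 : algebraMap R Q s ≠ 0 := (map_ne_zero_iff _ hinj).2 hs0
  have h2 : algebraMap R Q a ≠ 0 := (map_ne_zero_iff _ hinj).2 ha
  refine ⟨r * t, n, ?_⟩
  rw [Algebra.smul_def, map_mul, inv_pow, ← map_pow, div_eq_iff h1, ht, map_mul]
  have h3 : algebraMap R Q t ≠ 0 := by
    rintro h3
    have := congrArg (algebraMap R Q) ht
    rw [map_mul, h3, mul_zero, map_pow] at this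
    exact pow_ne_zero n h2 this
  field_simp

namespace IsLocalCompletion

variable {R A : Type*} [CommRing R] [IsLocalRing R] [CommRing A] [IsLocalRing A]
    [Algebra R A] [IsNoetherianRing A] (h : IsLocalCompletion R A)

include h in
theorem isFiniteLength_quotient {J : Ideal A} {n : ℕ} (hJ : maximalIdeal A ^ n ≤ J) :
    IsFiniteLength R (A ⧸ J) := by
  have := isArtinianRing_quotient_of_maximalIdeal_pow_le hJ
  rw [← Module.length_ne_top_iff, Module.length_eq_of_surjective (R := A ⧸ J) (fun y ↦ ?_)]
  · exact Module.length_ne_top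
  · obtain ⟨x, rfl⟩ := Ideal.Quotient.mk_surjective y
    obtain ⟨r, hr⟩ := h.exists_sub_mem n x
    exact ⟨r, ((Ideal.Quotient.eq).2 (hJ hr)).symm⟩

end IsLocalCompletion

/-- Multiplicity one. If `f` and `g` were independent over `A/q`, then with `ℓ n` the length of
`A/(bⁿ, q)`, evaluation at `a⁻ⁿ` would force `2 ℓ(n+1) ≤ ℓ(n) + const`, although `ℓ` is increasing,
finite and unbounded. -/
theorem IsLocalCompletion.exists_smul_add_smul_eq_zero {R A E : Type u} [CommRing R] [IsLocalRing R]
    [CommRing A] [IsLocalRing A] [Algebra R A] [IsNoetherianRing A] (h : IsLocalCompletion R A)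
    [IsDomain R] [IsNoetherianRing R] (hdim : ringKrullDim R = 1)
    (Q : Type v) [Field Q] [Algebra R Q] [IsFractionRing R Q]
    [AddCommGroup E] [Module R E] (hE : IsInjectiveHull R (R ⧸ maximalIdeal R) E)
    [Module A E] [IsScalarTower R A E] {q : Ideal A} (hq : q ∈ associatedPrimes A A)
    (f g : Q →ₗ[R] E) (hf : ∀ x ∈ q, x • f = 0) (hg : ∀ x ∈ q, x • g = 0) :
    ∃ x y : A, (x ∉ q ∨ y ∉ q) ∧ x • f + y • g = 0 := by
  by_contra! H
  have hqp := hq.isPrime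
  obtain ⟨a, ham, ha⟩ := exists_ne_zero_mem_maximalIdeal hdim
  set b := algebraMap R A a with hb
  have hbm : b ∈ maximalIdeal A := h.map_eq ▸ Ideal.mem_map_of_mem _ ham
  have hbq : b ∉ q := h.algebraMap_notMem_of_mem_associatedPrimes ha hq
  obtain ⟨k₀, hk₀⟩ := h.exists_pow_le_span hdim ha
  set u := (algebraMap R Q a)⁻¹ with hu
  have hau : ∀ n, u ^ n = a • u ^ (n + 1) := fun n ↦ by
    have : algebraMap R Q a ≠ 0 := (map_ne_zero_iff _ (IsFractionRing.injective R Q)).2 ha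
    rw [Algebra.smul_def, pow_succ', hu, mul_inv_cancel_left₀ this]
  let Θ : (Fin 2 → A) →ₗ[A] (Q →ₗ[R] E) := Fintype.linearCombination A ![f, g]
  have hΘ : ∀ z, Θ z = z 0 • f + z 1 • g := fun z ↦ by
    simp [Θ, Fintype.linearCombination_apply, Fin.sum_univ_two]
  have hΘ0 : ∀ z, Θ z = 0 ↔ ∀ i, z i ∈ q := by
    intro z
    rw [hΘ, Fin.forall_fin_two]
    refine ⟨fun hz ↦ ?_, fun hz ↦ by rw [hf _ hz.1, hg _ hz.2, add_zero]⟩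
    by_contra hcon
    exact H (z 0) (z 1) (by tauto) hz
  let T : ℕ → (Fin 2 → A) →ₗ[A] E := fun n ↦
    { toFun := fun z ↦ Θ z (u ^ n)
      map_add' := fun z w ↦ by rw [map_add, LinearMap.add_apply]
      map_smul' := fun c z ↦ by rw [map_smul, LinearMap.smul_apply, RingHom.id_apply] }
  have hT : ∀ n z, T n z = Θ z (u ^ n) := fun _ _ ↦ rfl
  have hTq : ∀ n z, (∀ i, z i ∈ q) → T n z = 0 := fun n z hz ↦ by
    rw [hT, (hΘ0 z).2 hz, LinearMap.zero_apply]
  have hTsucc : ∀ n z, T n z = b • T (n + 1) z := fun n z ↦ by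
    rw [hT, hT, hau, map_smul, hb, algebraMap_smul]
  have hTadd : ∀ n k z, T n z = b ^ k • T (n + k) z := by
    intro n k z
    induction k with
    | zero => simp
    | succ k ih => rw [ih, pow_succ, mul_smul, ← add_assoc, ← hTsucc]
  let L : ℕ → Submodule A (Fin 2 → A) := fun n ↦ LinearMap.ker (T n)
  have hL : Antitone L := antitone_nat_of_succ_le fun n z hz ↦ by
    have hz : T (n + 1) z = 0 := hz
    change T n z = 0
    rw [hTsucc, hz, smul_zero]
  have htors : ∀ y : Q, ∃ e, ∀ z : Fin 2 → A, (∀ i, z i ∈ maximalIdeal A ^ e) → Θ z y = 0 := by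
    intro y
    obtain ⟨e₁, h₁⟩ := hE.exists_pow_smul_eq_zero (f y)
    obtain ⟨e₂, h₂⟩ := hE.exists_pow_smul_eq_zero (g y)
    refine ⟨max e₁ e₂, fun z hz ↦ ?_⟩
    rw [hΘ, LinearMap.add_apply, LinearMap.smul_apply, LinearMap.smul_apply,
      h.smul_eq_zero_of_mem_pow h₁ (Ideal.pow_le_pow_right (le_max_left _ _) (hz 0)),
      h.smul_eq_zero_of_mem_pow h₂ (Ideal.pow_le_pow_right (le_max_right _ _) (hz 1)), add_zero]
  let J : ℕ → Ideal A := fun n ↦ Ideal.span {b ^ n} ⊔ q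
  -- The `L n` intersect in `q × q`, because the `a⁻ⁿ` generate `Q` over `R`; Chevalley's theorem
  -- applies.
  obtain ⟨N, hN⟩ : ∃ N, L N ≤ Submodule.pi Set.univ fun _ ↦ J 1 := by
    have := h.isAdicComplete
    have : IsPrecomplete (maximalIdeal A) (Fin 2 → A) := .pi _
    refine exists_le_of_antitone (maximalIdeal A) (isArtinian_quotient_pow_smul_top_pi _) L hL
      (fun n ↦ ?_) _ k₀ (fun z hz i _ ↦ ?_) fun z hz i _ ↦ ?_
    · obtain ⟨e, he⟩ := htors (u ^ n)
      exact ⟨e, fun z hz ↦ he z ((Submodule.mem_ideal_smul_top_pi _ z).1 hz)⟩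
    · refine Ideal.mem_sup_left ?_
      rw [pow_one]
      exact hk₀ ((Submodule.mem_ideal_smul_top_pi _ z).1 hz i)
    · refine Ideal.mem_sup_right ((hΘ0 z).1 (LinearMap.ext fun y ↦ ?_) i)
      obtain ⟨r, n, rfl⟩ := IsFractionRing.exists_smul_inv_pow hdim ham ha y
      have hz : T n z = 0 := (Submodule.mem_iInf _).1 hz n
      rw [map_smul, ← hu, ← hT, hz, smul_zero, LinearMap.zero_apply]
  -- Writing `z = b • y + w` with `w` in `q × q`, the value of `T` at `z` is that at `y` one level
  -- lower, so each level gains a factor `b`.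
  have hLJ : ∀ n, ∀ z ∈ L (n + N), ∀ i, z i ∈ J (n + 1) := by
    intro n
    induction n with
    | zero => exact fun z hz i ↦ hN (by rwa [zero_add] at hz) i trivial
    | succ n ih =>
      intro z hz
      have hz1 : ∀ i, ∃ y, ∃ w ∈ q, z i = b * y + w := by
        intro i
        obtain ⟨y, hy, w, hw, hyw⟩ :=
          Submodule.mem_sup.1 (hN (hL (Nat.le_add_left _ _) hz) i trivial)
        obtain ⟨y, rfl⟩ := Ideal.mem_span_singleton.1 hy
        exact ⟨y, w, hw, by rw [← hyw, pow_one]⟩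
      choose y w hw hzy using hz1
      have hzeq : z = b • y + w := funext hzy
      have hy : y ∈ L (n + N) := by
        have hz : T (n + 1 + N) z = 0 := hz
        change T (n + N) y = 0
        rw [hTsucc, ← map_smul, add_right_comm]
        rwa [hzeq, map_add, hTq _ w hw, add_zero] at hz
      intro i
      obtain ⟨c, hc, w', hw', hcw⟩ := Submodule.mem_sup.1 (ih y hy i)
      obtain ⟨c, rfl⟩ := Ideal.mem_span_singleton.1 hc
      have hzi : z i = b ^ (n + 1 + 1) * c + (b * w' + w i) := by
        rw [hzy, ← hcw]
        ring
      rw [hzi]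
      exact Submodule.add_mem_sup (Ideal.mem_span_singleton.2 ⟨c, rfl⟩)
        (q.add_mem (q.mul_mem_left _ hw') (hw i))
  -- `T 0` evaluates at `1 ∈ Q`, where `f` and `g` take only two values, so one power of `b` kills
  -- its whole image.
  obtain ⟨c, hc⟩ : ∃ c, ∀ z, b ^ c • T 0 z = 0 := by
    obtain ⟨c, hc⟩ := htors 1
    refine ⟨c, fun z ↦ ?_⟩
    rw [← map_smul, hT, pow_zero]
    exact hc _ fun i ↦ Ideal.mul_mem_right _ _ (Ideal.pow_mem_pow hbm c)
  have hkill : ∀ n, ∀ x ∈ J (n + c), ∀ z, x • T n z = 0 := by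
    intro n x hx z
    obtain ⟨y, hy, w, hw, rfl⟩ := Submodule.mem_sup.1 hx
    obtain ⟨y, rfl⟩ := Ideal.mem_span_singleton.1 hy
    have h1 : w • T n z = 0 := by
      rw [← map_smul]
      exact hTq n _ fun i ↦ q.mul_mem_right _ hw
    have h2 : b ^ n • T n z = T 0 z := by
      rw [hTadd 0 n z, zero_add]
    rw [add_smul, h1, add_zero, mul_comm, mul_smul, add_comm n c, pow_add, mul_smul, h2,
      hc, smul_zero]
  let ℓ : ℕ → ℕ∞ := fun n ↦ Module.length R (A ⧸ J n)
  have hfin : ∀ n, IsFiniteLength R (A ⧸ J n) := fun n ↦ by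
    refine h.isFiniteLength_quotient (n := k₀ * n) (le_trans ?_ le_sup_left)
    rw [pow_mul, ← Ideal.span_singleton_pow]
    exact Ideal.pow_right_mono hk₀ n
  have hℓ : ∀ n, ℓ n ≠ ⊤ := fun n ↦ Module.length_ne_top_iff.2 (hfin n)
  -- The image of `T (n + N)` surjects onto two copies of `A ⧸ J (n + 1)`, while being killed by `J
  -- (n + N + c)`.
  have hupper : ∀ n, ℓ (n + 1) + ℓ (n + 1) ≤ ℓ (n + N + c) := by
    intro n
    let Tn : (Fin 2 → A) →ₗ[R] E := (T (n + N)).restrictScalars R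
    have h1 : Module.length R (LinearMap.range Tn) ≤ ℓ (n + N + c) := by
      refine hE.length_le_of_smul_eq_zero (J _) (hfin _) _ ?_
      rintro x hx _ ⟨z, rfl⟩
      exact hkill _ x hx z
    let π : (Fin 2 → A) →ₗ[R] Fin 2 → A ⧸ J (n + 1) :=
      LinearMap.pi fun i ↦ ((J (n + 1)).mkQ.restrictScalars R) ∘ₗ LinearMap.proj i
    have hπ : Function.Surjective π := by
      intro y
      choose z hz using fun i ↦ Submodule.Quotient.mk_surjective _ (y i)
      exact ⟨z, funext hz⟩
    have hker : LinearMap.ker Tn ≤ LinearMap.ker π := fun z hz ↦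
      funext fun i ↦ (Submodule.Quotient.mk_eq_zero _).2 (hLJ n z hz i)
    have h2 : ℓ (n + 1) + ℓ (n + 1) = Module.length R (Fin 2 → A ⧸ J (n + 1)) := by
      rw [Module.length_pi_of_fintype, Fin.sum_univ_two]
    rw [h2]
    refine le_trans ?_ h1
    rw [← Tn.quotKerEquivRange.length_eq]
    refine Module.length_le_of_surjective ((LinearMap.ker Tn).liftQ π hker) fun y ↦ ?_
    obtain ⟨z, rfl⟩ := hπ y
    exact ⟨Submodule.Quotient.mk z, rfl⟩
  have hbound : ∀ n, ℓ (n + 1) ≤ ℓ (N + c) := by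
    intro n
    have h1 : ℓ (n + N + c) ≤ ℓ (N + c) + ℓ n :=
      add_assoc n N c ▸ length_quotient_pow_sup_add_le R b q n (N + c)
    have h2 : ℓ n ≤ ℓ (n + 1) := by
      have hJ : J (n + 1) ≤ J n := sup_le_sup_right
        (Ideal.span_singleton_le_span_singleton.2 (pow_dvd_pow b (Nat.le_succ _))) q
      exact Module.length_le_of_surjective ((Submodule.factor hJ).restrictScalars R)
        (Submodule.factor_surjective hJ)
    have h3 := (hupper n).trans (h1.trans (add_le_add_right h2 _))
    -- Cancelling one copy of `ℓ (n + 1)` requires its finiteness.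
    exact (ENat.add_le_add_iff_right (hℓ (n + 1))).1 (by exact h3)
  obtain ⟨m, hm⟩ := ENat.ne_top_iff_exists.1 (hℓ (N + c))
  have h1 := (le_length_quotient_pow_sup R b q hbm hbq (m + 1)).trans (hbound m)
  rw [← hm] at h1
  exact absurd (Nat.cast_le.1 h1) (Nat.not_succ_le_self m)

/-! ### Essential maps and injective modules -/

/-- A linear map is essential if every nonzero element of its codomain has a nonzero multiple in
its range. -/
def LinearMap.IsEssential {A M N : Type*} [CommRing A] [AddCommGroup M] [Module A M]
    [AddCommGroup N] [Module A N] (f : M →ₗ[A] N) : Prop :=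
  ∀ y : N, y ≠ 0 → ∃ r : A, r • y ≠ 0 ∧ r • y ∈ LinearMap.range f

section Essential

variable {A : Type*} [CommRing A]

theorem LinearMap.isEssential_of_inf_range {M N : Type*} [AddCommGroup M] [Module A M]
    [AddCommGroup N] [Module A N] {f : M →ₗ[A] N}
    (hf : ∀ L : Submodule A N, L ⊓ LinearMap.range f = ⊥ → L = ⊥) : f.IsEssential := by
  intro y hy
  by_contra! hcon
  refine hy (Submodule.span_singleton_eq_bot.1 (hf (A ∙ y) ((Submodule.eq_bot_iff _).2 ?_)))
  rintro z ⟨h1, h2⟩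
  obtain ⟨r, rfl⟩ := Submodule.mem_span_singleton.1 h1
  by_contra hr
  exact hcon r hr h2

theorem LinearMap.IsEssential.injective_of_comp {M N P : Type*} [AddCommGroup M] [Module A M]
    [AddCommGroup N] [Module A N] [AddCommGroup P] [Module A P] {f : M →ₗ[A] N}
    (hf : f.IsEssential) (g : N →ₗ[A] P) (hgf : Function.Injective (g ∘ₗ f)) :
    Function.Injective g := by
  rw [injective_iff_map_eq_zero]
  intro y hy
  by_contra hy0
  obtain ⟨r, hr, m, hm⟩ := hf y hy0
  have : (g ∘ₗ f) m = (g ∘ₗ f) 0 := by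
    rw [LinearMap.comp_apply, hm, map_smul, hy, smul_zero, map_zero]
  rw [hgf this, map_zero] at hm
  exact hr hm.symm

theorem LinearMap.IsEssential.pi {ι : Type*} [Finite ι] {M N : ι → Type*}
    [∀ i, AddCommGroup (M i)] [∀ i, Module A (M i)] [∀ i, AddCommGroup (N i)]
    [∀ i, Module A (N i)] {f : ∀ i, M i →ₗ[A] N i} (hf : ∀ i, (f i).IsEssential) :
    (LinearMap.piMap f).IsEssential := by
  classical
  have := Fintype.ofFinite ι
  intro y hy
  -- Coordinates are treated one at a time: one already killed lies in the range, and otherwise the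
  -- multiplier keeps that coordinate, hence the vector, nonzero.
  have key : ∀ s : Finset ι, ∃ r : A, r • y ≠ 0 ∧ ∀ i ∈ s, r • y i ∈ LinearMap.range (f i) := by
    intro s
    induction s using Finset.induction_on with
    | empty => exact ⟨1, by rwa [one_smul], by simp⟩
    | insert i s _ ih =>
      obtain ⟨r, hr, hrs⟩ := ih
      by_cases h0 : r • y i = 0
      · refine ⟨r, hr, fun j hj ↦ ?_⟩
        rcases Finset.mem_insert.1 hj with rfl | hj
        · rw [h0]; exact zero_mem _
        · exact hrs j hj
      · obtain ⟨t, ht, htr⟩ := hf i _ h0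
        refine ⟨t * r, fun h ↦ ht ?_, fun j hj ↦ ?_⟩
        · rw [← mul_smul]
          exact congrFun h i
        · rw [mul_smul]
          rcases Finset.mem_insert.1 hj with rfl | hj
          · exact htr
          · exact Submodule.smul_mem _ _ (hrs j hj)
  obtain ⟨r, hr, h⟩ := key Finset.univ
  choose m hm using fun i ↦ h i (Finset.mem_univ i)
  exact ⟨r, hr, m, funext hm⟩

/-- Extending `g` along `f` gives an injective `φ`, with a left inverse `ψ`. Since `ψ ∘ g = f` is
injective and `g` is essential, `ψ` is injective too, so `φ` is onto. -/
theorem nonempty_linearEquiv_of_isEssential {M Y Z : Type*} [AddCommGroup M] [Module A M]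
    [AddCommGroup Y] [Module A Y] [AddCommGroup Z] [Module A Z] (hY : Module.Baer A Y)
    (hZ : Module.Baer A Z) (f : M →ₗ[A] Y) (g : M →ₗ[A] Z) (hf : Function.Injective f)
    (hg : Function.Injective g) (hf' : f.IsEssential) (hg' : g.IsEssential) :
    Nonempty (Y ≃ₗ[A] Z) := by
  obtain ⟨φ, hφ⟩ := hZ.extension_property f hf g
  have hφi : Function.Injective φ := hf'.injective_of_comp φ (hφ ▸ hg)
  obtain ⟨ψ, hψ⟩ := hY.extension_property φ hφi LinearMap.id
  have hψi : Function.Injective ψ := by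
    refine hg'.injective_of_comp ψ ?_
    rw [← hφ, ← LinearMap.comp_assoc, hψ, LinearMap.id_comp]
    exact hf
  refine ⟨LinearEquiv.ofBijective φ ⟨hφi, fun z ↦ ⟨ψ z, hψi ?_⟩⟩⟩
  exact LinearMap.congr_fun hψ (ψ z)

end Essential

theorem Module.Baer.pi {A ι : Type*} [CommRing A] {N : ι → Type*}
    [∀ i, AddCommGroup (N i)] [∀ i, Module A (N i)] (h : ∀ i, Module.Baer A (N i)) :
    Module.Baer A (∀ i, N i) := by
  intro I g
  choose g' hg' using fun i ↦ h i I (LinearMap.proj i ∘ₗ g)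
  exact ⟨LinearMap.pi g', fun x hx ↦ funext fun i ↦ hg' i x hx⟩

/-- Maps from a flat module into an injective module over an algebra form an injective module. -/
theorem Module.Baer.linearMap {R A E Q : Type*} [CommRing R] [CommRing A] [Algebra R A]
    [AddCommGroup E] [Module R E] [Module A E] [IsScalarTower R A E] [AddCommGroup Q] [Module R Q]
    [Module.Flat R Q] (hE : Module.Baer A E) : Module.Baer A (Q →ₗ[R] E) := by
  intro I g
  -- By tensor-hom adjunction, extending `g` amounts to extending a map along `I ⊗ Q → A ⊗ Q`,
  -- injective by flatness.
  let ι : I ⊗[R] Q →ₗ[A] A ⊗[R] Q := TensorProduct.AlgebraTensorModule.rTensor R Q I.subtype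
  have hι : Function.Injective ι :=
    Module.Flat.rTensor_preserves_injective_linearMap (M := Q) (I.subtype.restrictScalars R)
      I.subtype_injective
  obtain ⟨e, he⟩ := hE.extension_property ι hι (TensorProduct.AlgebraTensorModule.lift g)
  refine ⟨TensorProduct.AlgebraTensorModule.curry e, fun x hx ↦ LinearMap.ext fun y ↦ ?_⟩
  exact LinearMap.congr_fun he ((⟨x, hx⟩ : I) ⊗ₜ[R] y)

theorem eq_zero_of_algebraMap_smul_eq_zero {R A E Q : Type*} [CommRing R] [CommRing A]
    [Algebra R A] [AddCommGroup E] [Module R E] [Module A E] [IsScalarTower R A E] [Field Q]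
    [Algebra R Q] [IsDomain R] [IsFractionRing R Q] {r : R} (hr : r ≠ 0) {f : Q →ₗ[R] E}
    (hf : algebraMap R A r • f = 0) : f = 0 := by
  ext y
  have hr' : algebraMap R Q r ≠ 0 := (map_ne_zero_iff _ (IsFractionRing.injective R Q)).2 hr
  have h1 : y = r • ((algebraMap R Q r)⁻¹ * y) := by
    rw [Algebra.smul_def, mul_inv_cancel_left₀ hr']
  rw [h1, map_smul, ← algebraMap_smul A r, ← LinearMap.smul_apply, hf, LinearMap.zero_apply,
    LinearMap.zero_apply]

theorem tmul_one_injective {R X Q : Type*} [CommRing R] [AddCommGroup X] [Module R X]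
    [Field Q] [Algebra R Q] [IsFractionRing R Q]
    (hX : ∀ r ∈ nonZeroDivisors R, ∀ x : X, r • x = 0 → x = 0) :
    Function.Injective fun x : X ↦ x ⊗ₜ[R] (1 : Q) := by
  have hloc : IsLocalizedModule (nonZeroDivisors R) (TensorProduct.mk R Q X 1) :=
    (isLocalizedModule_iff_isBaseChange (nonZeroDivisors R) Q _).2
      (TensorProduct.isBaseChange R X Q)
  have hinj : Function.Injective (TensorProduct.mk R Q X 1) := by
    rw [injective_iff_map_eq_zero]
    intro x hx
    obtain ⟨c, hc⟩ := (IsLocalizedModule.eq_zero_iff (nonZeroDivisors R) _).1 hx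
    exact hX c c.2 x hc
  intro x y hxy
  exact hinj ((TensorProduct.comm R X Q).congr_arg hxy)

/-! ### The module `Hom_R(Q, E)` as an injective hull -/

namespace IsLocalCompletion

variable {R A : Type*} [CommRing R] [IsLocalRing R] [CommRing A] [IsLocalRing A]
    [Algebra R A] [IsNoetherianRing A] (h : IsLocalCompletion R A) [IsDomain R]
    (hdim : ringKrullDim R = 1)

include h hdim

theorem exists_notMem_forall_mem {q : Ideal A} (hq : q ∈ associatedPrimes A A) :
    ∃ t ∉ q, ∀ p ∈ associatedPrimes A A, p ≠ q → t ∈ p := by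
  classical
  have hfin : (associatedPrimes A A).Finite := associatedPrimes.finite A A
  have hqp := hq.isPrime
  have hw : ∀ p : Ideal A, ∃ w ∉ q, p ∈ associatedPrimes A A → p ≠ q → w ∈ p := by
    intro p
    by_cases hp : p ∈ associatedPrimes A A ∧ p ≠ q
    · obtain ⟨w, hwp, hwq⟩ := SetLike.not_le_iff_exists.1
        fun hle ↦ hp.2 (h.eq_of_le_of_mem_associatedPrimes hdim hp.1 hq hle)
      exact ⟨w, hwq, fun _ _ ↦ hwp⟩
    · exact ⟨1, fun h1 ↦ hqp.ne_top ((Ideal.eq_top_iff_one _).2 h1), fun h1 h2 ↦ (hp ⟨h1, h2⟩).elim⟩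
  choose w hwq hwp using hw
  refine ⟨∏ p ∈ hfin.toFinset, w p, fun hmem ↦ ?_, fun p hp hpq ↦ ?_⟩
  · obtain ⟨p, -, hp⟩ := hqp.prod_mem_iff.1 hmem
    exact hwq p hp
  · exact Ideal.mem_of_dvd _ (Finset.dvd_prod_of_mem w (hfin.mem_toFinset.2 hp)) (hwp p hp hpq)

end IsLocalCompletion

section Hom

variable {R A E : Type u} [CommRing R] [IsLocalRing R]
    [CommRing A] [IsLocalRing A] [Algebra R A] [IsNoetherianRing A] (h : IsLocalCompletion R A)
    [IsDomain R] [IsNoetherianRing R] (hdim : ringKrullDim R = 1)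
    (Q : Type v) [Field Q] [Algebra R Q] [IsFractionRing R Q]
    [AddCommGroup E] [Module R E] (hE : IsInjectiveHull R (R ⧸ maximalIdeal R) E)
    [Module A E] [IsScalarTower R A E]

include h hdim hE

/-- The composite `A/q → A/m → E` extends to `A/q ⊗ Q`, since `A/q` is torsion-free over `R`;
restricting to `1 ⊗ Q` gives a nonzero `f` killed by `q`. A further annihilator outside `q` would
make a power of `a` kill `f`, but nonzero elements of `R` act injectively on maps out of `Q`. -/
theorem IsLocalCompletion.exists_smul_eq_zero_iff {q : Ideal A} (hq : q ∈ associatedPrimes A A) :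
    ∃ f : Q →ₗ[R] E, ∀ x : A, x • f = 0 ↔ x ∈ q := by
  have hqp := hq.isPrime
  have hbaer : Module.Baer A E := h.baer hE.1 hE.exists_pow_smul_eq_zero
  obtain ⟨-, k, hk, -⟩ := hE
  have he : ∀ x ∈ maximalIdeal A, x • k 1 = 0 := fun x hx ↦ by
    refine h.smul_eq_zero_of_mem_pow (n := 1) (fun t ht ↦ ?_) (by rwa [pow_one])
    rw [pow_one] at ht
    have : t • (1 : R ⧸ maximalIdeal R) = 0 := by
      rw [Algebra.smul_def, mul_one]
      exact Ideal.Quotient.eq_zero_iff_mem.2 ht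
    rw [← map_smul, this, map_zero]
  have he0 : k 1 ≠ 0 := (map_ne_zero_iff k hk).2 one_ne_zero
  let ψ : A ⧸ q →ₗ[A] E := Submodule.liftQ q (LinearMap.toSpanSingleton A E (k 1))
    fun x hx ↦ he x (le_maximalIdeal hqp.ne_top hx)
  let ι : A ⧸ q →ₗ[A] (A ⧸ q) ⊗[R] Q := (TensorProduct.AlgebraTensorModule.mk R A (A ⧸ q) Q).flip 1
  have hι : Function.Injective ι := by
    refine tmul_one_injective fun r hr x hx ↦ ?_
    obtain ⟨x, rfl⟩ := Ideal.Quotient.mk_surjective x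
    rw [Algebra.smul_def, IsScalarTower.algebraMap_apply R A (A ⧸ q), Ideal.Quotient.algebraMap_eq,
      ← map_mul, Ideal.Quotient.eq_zero_iff_mem] at hx
    exact Ideal.Quotient.eq_zero_iff_mem.2 ((hqp.mem_or_mem hx).resolve_left
      (h.algebraMap_notMem_of_mem_associatedPrimes (nonZeroDivisors.ne_zero hr) hq))
  obtain ⟨Ψ, hΨ⟩ := hbaer.extension_property ι hι ψ
  let f : Q →ₗ[R] E := TensorProduct.AlgebraTensorModule.curry Ψ (Submodule.Quotient.mk 1)
  have hqf : ∀ x ∈ q, x • f = 0 := fun x hx ↦ by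
    have : x • (Submodule.Quotient.mk 1 : A ⧸ q) = 0 := by
      rw [← Submodule.Quotient.mk_smul, Submodule.Quotient.mk_eq_zero, smul_eq_mul, mul_one]
      exact hx
    rw [← map_smul, this, map_zero]
  have hf1 : f ≠ 0 := fun h0 ↦ he0 (by
    have h1 : f 1 = (1 : A) • k 1 := LinearMap.congr_fun hΨ (Submodule.Quotient.mk 1)
    rw [← one_smul A (k 1), ← h1, h0, LinearMap.zero_apply])
  refine ⟨f, fun x ↦ ⟨fun hx ↦ ?_, hqf x⟩⟩
  by_contra hxq
  obtain ⟨n, hn⟩ := h.exists_pow_le_of_not_le hdim (q ⊔ Ideal.span {x}) fun p hp hle ↦ hxq (by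
    rw [h.eq_of_le_of_mem_associatedPrimes hdim hq hp (le_sup_left.trans hle)]
    exact hle (Ideal.mem_sup_right (Ideal.mem_span_singleton_self x)))
  obtain ⟨a, ham, ha⟩ := exists_ne_zero_mem_maximalIdeal hdim
  have hmem : algebraMap R A (a ^ n) ∈ q ⊔ Ideal.span {x} := by
    rw [map_pow]
    exact hn (Ideal.pow_mem_pow (h.map_eq ▸ Ideal.mem_map_of_mem _ ham) n)
  refine hf1 (eq_zero_of_algebraMap_smul_eq_zero (A := A) (pow_ne_zero n ha) ?_)
  obtain ⟨y, hy, z, hz, hyz⟩ := Submodule.mem_sup.1 hmem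
  obtain ⟨c, rfl⟩ := Ideal.mem_span_singleton'.1 hz
  rw [← hyz, add_smul, hqf y hy, mul_smul, hx, smul_zero, add_zero]

theorem IsLocalCompletion.exists_isEssential :
    ∃ Φ : ((q : associatedPrimes A A) → A ⧸ (q : Ideal A)) →ₗ[A] (Q →ₗ[R] E),
      Function.Injective Φ ∧ Φ.IsEssential := by
  classical
  have : Fintype (associatedPrimes A A) := (associatedPrimes.finite A A).fintype
  choose f hf using fun q : associatedPrimes A A ↦ h.exists_smul_eq_zero_iff hdim Q hE q.2
  let Φ : ((q : associatedPrimes A A) → A ⧸ (q : Ideal A)) →ₗ[A] (Q →ₗ[R] E) :=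
    LinearMap.lsum A (fun q : associatedPrimes A A ↦ A ⧸ (q : Ideal A)) A fun q ↦
      Submodule.liftQ (q : Ideal A) (LinearMap.toSpanSingleton A _ (f q))
        fun x hx ↦ (hf q x).2 hx
  have hΦ : ∀ z : associatedPrimes A A → A,
      Φ (fun q ↦ Submodule.Quotient.mk (z q)) = ∑ q, z q • f q := fun z ↦ by
    simp only [Φ, LinearMap.lsum_apply, LinearMap.sum_apply]
    rfl
  refine ⟨Φ, ?_, fun v hv ↦ ?_⟩
  · rw [injective_iff_map_eq_zero]
    intro z hz
    choose r hr using fun q ↦ Submodule.Quotient.mk_surjective _ (z q)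
    obtain rfl : (fun q ↦ Submodule.Quotient.mk (r q)) = z := funext hr
    rw [hΦ] at hz
    funext q
    have hqp := q.2.isPrime
    -- Multiplying by `t` isolates the component at `q`.
    obtain ⟨t, htq, ht⟩ := h.exists_notMem_forall_mem hdim q.2
    have h1 : (t * r q) • f q = 0 := by
      rw [mul_smul, ← smul_zero t, ← hz, Finset.smul_sum, Finset.sum_eq_single q]
      · intro p _ hpq
        rw [smul_smul, (hf p _).2 (Ideal.mul_mem_right _ _ (ht p p.2 fun h ↦ hpq (Subtype.ext h)))]
      · simp
    exact (Submodule.Quotient.mk_eq_zero _).2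
      ((hqp.mem_or_mem ((hf q _).1 h1)).resolve_left htq)
  · obtain ⟨p, hp, hle⟩ := exists_le_isAssociatedPrime_of_isNoetherianRing A
      (⟨v, Submodule.mem_span_singleton_self v⟩ : A ∙ v) fun h0 ↦ hv (congrArg Subtype.val h0)
    obtain ⟨hpp, ⟨w, hw⟩, hpw⟩ := isAssociatedPrime_iff.1 hp
    obtain ⟨s, rfl⟩ := Submodule.mem_span_singleton.1 hw
    have hpw' : ∀ x, x ∈ p ↔ x • s • v = 0 := fun x ↦ by
      rw [hpw, Submodule.mem_colon_singleton, Submodule.mem_bot, Subtype.ext_iff]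
      rfl
    obtain ⟨a, ham, ha⟩ := exists_ne_zero_mem_maximalIdeal hdim
    have hpA : p ∈ associatedPrimes A A := by
      rw [h.mem_associatedPrimes_iff hdim]
      rintro rfl
      have h0 : s • v = 0 := eq_zero_of_algebraMap_smul_eq_zero (A := A) ha
        ((hpw' _).1 (h.map_eq ▸ Ideal.mem_map_of_mem _ ham))
      refine hpp.ne_top ((Ideal.eq_top_iff_one _).2 ((hpw' 1).2 ?_))
      rw [h0, smul_zero]
    let q : associatedPrimes A A := ⟨p, hpA⟩
    -- Both `s • v` and `f q` are killed by `p`, so multiplicity one relates them. The coefficient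
    -- of `s • v` is outside `p`, as `f q` has annihilator exactly `p`.
    obtain ⟨x, y, hxy, h0⟩ := h.exists_smul_add_smul_eq_zero hdim Q hE hpA (s • v) (f q)
      (fun x hx ↦ (hpw' x).1 hx) (fun x hx ↦ (hf q x).2 hx)
    have hx : x ∉ p := by
      rcases hxy with hx | hy
      · exact hx
      · intro hx
        rw [(hpw' x).1 hx, zero_add] at h0
        exact hy ((hf q y).1 h0)
    refine ⟨x * s, fun h1 ↦ hx ((hpw' x).2 (by rwa [smul_smul])),
      Pi.single q (Submodule.Quotient.mk (-y)), ?_⟩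
    rw [mul_smul, eq_neg_of_add_eq_zero_left h0, ← neg_smul]
    exact LinearMap.lsum_piSingle ..

/-- The Matlis dual of the fraction field is the sum of the injective hulls of the quotients of the
completion by its associated primes. -/
theorem IsLocalCompletion.nonempty_linearEquiv
    (F : associatedPrimes A A → Type u) [∀ q, AddCommGroup (F q)] [∀ q, Module A (F q)]
    (hF : ∀ q : associatedPrimes A A, IsInjectiveHull A (A ⧸ (q : Ideal A)) (F q)) :
    Nonempty ((Q →ₗ[R] E) ≃ₗ[A] ⨁ q, F q) := by
  classical
  have : Fintype (associatedPrimes A A) := (associatedPrimes.finite A A).fintype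
  have : Module.Flat R Q := IsLocalization.flat Q (nonZeroDivisors R)
  have hbaer : Module.Baer A E := h.baer hE.1 hE.exists_pow_smul_eq_zero
  obtain ⟨Φ, hΦ, hΦ'⟩ := h.exists_isEssential hdim Q hE
  choose hFi j hj hj' using hF
  obtain ⟨e⟩ := nonempty_linearEquiv_of_isEssential hbaer.linearMap
    (Module.Baer.pi fun q ↦ Module.Baer.of_injective (hFi q)) Φ (LinearMap.piMap j) hΦ
    (fun x y hxy ↦ funext fun q ↦ hj q (congrFun hxy q)) hΦ'
    (LinearMap.IsEssential.pi fun q ↦ LinearMap.isEssential_of_inf_range (hj' q))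
  exact ⟨e.trans (DirectSum.linearEquivFunOnFintype A _ F).symm⟩

end Hom

/-! ### The generic formal fibre -/

namespace IsLocalCompletion

variable {R A : Type*} [CommRing R] [IsLocalRing R] [CommRing A] [IsLocalRing A]
    [Algebra R A] [IsNoetherianRing A] (h : IsLocalCompletion R A) [IsDomain R]
    (hdim : ringKrullDim R = 1)

include h hdim

theorem krullDimLE_localization (q : associatedPrimes A A) :
    Ring.KrullDimLE 0 (Localization.AtPrime (q : Ideal A)) :=
  .of_isLocalization _ (h.mem_minimalPrimes hdim q ((h.mem_associatedPrimes_iff hdim q).1 q.2)) _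

/-- A stand-in for the idempotent of the factor at `q`: an element of all the other associated
primes is nilpotent in their zero-dimensional localizations, and a large power works for all at
once. -/
theorem exists_notMem_forall_algebraMap_eq_zero (q : associatedPrimes A A) :
    ∃ t ∉ (q : Ideal A), ∀ p : associatedPrimes A A, p ≠ q →
      algebraMap A (Localization.AtPrime (p : Ideal A)) t = 0 := by
  classical
  have : Fintype (associatedPrimes A A) := (associatedPrimes.finite A A).fintype
  obtain ⟨t, htq, ht⟩ := h.exists_notMem_forall_mem hdim q.2
  have hnil : ∀ p : associatedPrimes A A, ∃ n, p ≠ q →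
      algebraMap A (Localization.AtPrime (p : Ideal A)) t ^ n = 0 := by
    intro p
    by_cases hpq : p = q
    · exact ⟨0, fun h ↦ (h hpq).elim⟩
    · have := h.krullDimLE_localization hdim p
      have hmem : algebraMap A (Localization.AtPrime (p : Ideal A)) t ∈
          maximalIdeal (Localization.AtPrime (p : Ideal A)) :=
        (IsLocalization.AtPrime.to_map_mem_maximal_iff _ (p : Ideal A) t).2
          (ht p p.2 fun h ↦ hpq (Subtype.ext h))
      obtain ⟨n, hn⟩ := Ring.KrullDimLE.isNilpotent_iff_mem_maximalIdeal.2 hmem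
      exact ⟨n, fun _ ↦ hn⟩
  choose n hn using hnil
  refine ⟨t ^ ∑ p, n p, fun hmem ↦ htq (q.2.isPrime.mem_of_pow_mem _ hmem), fun p hpq ↦ ?_⟩
  rw [map_pow]
  exact pow_eq_zero_of_le (Finset.single_le_sum (fun _ _ ↦ Nat.zero_le _) (Finset.mem_univ p))
    (hn p hpq)

/-- The product of the localizations of the completion at its associated primes is the localization
of the completion at the nonzero elements of the base. -/
theorem isLocalization_pi [IsNoetherianRing R] :
    IsLocalization (Algebra.algebraMapSubmonoid A (nonZeroDivisors R))
      ((q : associatedPrimes A A) → Localization.AtPrime (q : Ideal A)) := by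
  obtain ⟨a, ham, ha⟩ := exists_ne_zero_mem_maximalIdeal hdim
  have hpow : ∀ J : Ideal A, (∀ q : associatedPrimes A A, ¬ J ≤ q) →
      ∃ c : Algebra.algebraMapSubmonoid A (nonZeroDivisors R), (c : A) ∈ J := by
    intro J hJ
    obtain ⟨n, hn⟩ := h.exists_pow_le_of_not_le hdim J fun q hq ↦ hJ ⟨q, hq⟩
    refine ⟨⟨algebraMap R A (a ^ n), Algebra.mem_algebraMapSubmonoid_of_mem
      (⟨a ^ n, mem_nonZeroDivisors_of_ne_zero (pow_ne_zero n ha)⟩ : nonZeroDivisors R)⟩, hn ?_⟩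
    change algebraMap R A (a ^ n) ∈ _
    rw [map_pow]
    exact Ideal.pow_mem_pow (h.map_eq ▸ Ideal.mem_map_of_mem _ ham) n
  refine ⟨?_, fun z ↦ ?_, fun {x y} hxy ↦ ?_⟩
  · rintro ⟨_, r, hr, rfl⟩
    rw [Pi.isUnit_iff]
    intro q
    exact IsLocalization.map_units (Localization.AtPrime (q : Ideal A))
      (⟨algebraMap R A r, h.algebraMap_notMem_of_mem_associatedPrimes
        (nonZeroDivisors.ne_zero hr) q.2⟩ : (q : Ideal A).primeCompl)
  -- `J` is the ideal of denominators of `z`. For each `q`, a denominator of the component `z q`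
  -- times the separating element `t` is in `J` but not in `q`.
  · let J : Ideal A := Submodule.comap (LinearMap.toSpanSingleton A _ z) (LinearMap.range
      (Algebra.linearMap A ((q : associatedPrimes A A) → Localization.AtPrime (q : Ideal A))))
    obtain ⟨c, x, hx⟩ := hpow J fun q hle ↦ by
      obtain ⟨t, htq, ht⟩ := h.exists_notMem_forall_algebraMap_eq_zero hdim q
      obtain ⟨⟨y, s⟩, hys⟩ := IsLocalization.surj
        (q : Ideal A).primeCompl (z q)
      have hmem : (s : A) * t ∈ J := by
        refine ⟨y * t, funext fun p ↦ ?_⟩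
        change algebraMap A _ (y * t) = ((s : A) * t) • z p
        rw [Algebra.smul_def, map_mul, map_mul]
        by_cases hp : p = q
        · obtain rfl := hp
          rw [← hys]
          ring
        · rw [ht p hp, mul_zero, mul_zero, zero_mul]
      exact (q.2.isPrime.mem_or_mem (hle hmem)).elim s.2 htq
    refine ⟨(x, c), ?_⟩
    rw [mul_comm, ← Algebra.smul_def]
    exact hx.symm
  · obtain ⟨c, hc⟩ := hpow (LinearMap.ker (LinearMap.toSpanSingleton A A (x - y))) fun q hle ↦ by
      obtain ⟨c, hc⟩ := IsLocalization.exists_of_eq (M := (q : Ideal A).primeCompl)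
        (congrFun hxy q)
      refine c.2 (hle ?_)
      change (c : A) * (x - y) = 0
      rw [mul_sub, hc, sub_self]
    refine ⟨c, ?_⟩
    have hc : (c : A) * (x - y) = 0 := hc
    rwa [mul_sub, sub_eq_zero] at hc

attribute [local instance] Algebra.TensorProduct.rightAlgebra in
/-- The formal fibre ring over the generic point is the product of the completed local rings of the
completion at its associated primes. -/
theorem nonempty_algEquiv [IsNoetherianRing R] (Q : Type*) [Field Q] [Algebra R Q]
    [IsFractionRing R Q] :
    Nonempty ((Q ⊗[R] A) ≃ₐ[A] ((q : associatedPrimes A A) →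
      LocalCompletion (Localization.AtPrime (q : Ideal A)))) := by
  have := h.isLocalization_pi hdim
  -- An Artinian local ring is complete for its maximal ideal, so each factor agrees with its
  -- completion.
  have hart : ∀ q : associatedPrimes A A, IsArtinianRing (Localization.AtPrime (q : Ideal A)) :=
    fun q ↦ by
      have := h.krullDimLE_localization hdim q
      have : IsNoetherianRing (Localization.AtPrime (q : Ideal A)) :=
        IsLocalization.isNoetherianRing (q : Ideal A).primeCompl _ inferInstance
      exact isArtinianRing_iff_isNoetherianRing_krullDimLE_zero.2 ⟨inferInstance, inferInstance⟩
  exact ⟨(IsLocalization.algEquiv (Algebra.algebraMapSubmonoid A (nonZeroDivisors R)) _ _).trans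
    (AlgEquiv.piCongrRight fun q : associatedPrimes A A ↦ (AdicCompletion.ofAlgEquiv
      (maximalIdeal (Localization.AtPrime (q : Ideal A)))).restrictScalars A)⟩

end IsLocalCompletion

end

theorem theorem3p3 (R : Type u) [CommRing R] [IsDomain R] [IsLocalRing R] [IsNoetherianRing R]
    (hdim : ringKrullDim R = 1)
    (Q : Type v) [Field Q] [Algebra R Q] [IsFractionRing R Q]
    (E : Type u) [AddCommGroup E] [Module R E]
    (hE : IsInjectiveHull R (R ⧸ IsLocalRing.maximalIdeal R) E)
    (F : associatedPrimes (LocalCompletion R) (LocalCompletion R) → Type u)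
    [∀ q, AddCommGroup (F q)] [∀ q, Module (LocalCompletion R) (F q)]
    (hF : ∀ q : associatedPrimes (LocalCompletion R) (LocalCompletion R),
      IsInjectiveHull (LocalCompletion R) (LocalCompletion R ⧸ (q : Ideal (LocalCompletion R)))
        (F q)) :
    (associatedPrimes (LocalCompletion R) (LocalCompletion R)).Finite ∧
    -- `E` has a module structure over the completion that extends its `R`-module structure
    (∃ _ : Module (LocalCompletion R) E, IsScalarTower R (LocalCompletion R) E) ∧
    -- for every such structure, `Hom_R(Q, E)` with the action through `E` is the direct sum
    (∀ [Module (LocalCompletion R) E] [IsScalarTower R (LocalCompletion R) E],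
      Nonempty ((Q →ₗ[R] E) ≃ₗ[LocalCompletion R] ⨁ q, F q)) ∧
    -- the base change of `Q`, an algebra over the completion through its right factor
    (letI : Algebra (LocalCompletion R) (Q ⊗[R] LocalCompletion R) :=
        Algebra.TensorProduct.rightAlgebra;
      Nonempty ((Q ⊗[R] LocalCompletion R) ≃ₐ[LocalCompletion R]
        ((q : associatedPrimes (LocalCompletion R) (LocalCompletion R)) →
          LocalCompletion (Localization.AtPrime (q : Ideal (LocalCompletion R)))))) := by
  have h := isLocalCompletion_localCompletion R
  have : IsNoetherianRing (LocalCompletion R) := h.isNoetherianRing hdim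
  exact ⟨associatedPrimes.finite _ _, exists_module_adicCompletion _ hE.exists_pow_smul_eq_zero,
    h.nonempty_linearEquiv hdim Q hE F hF, h.nonempty_algEquiv hdim Q⟩
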